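/- Let $c > e^{-\pi/\sqrt3}$ (the supercritical case). Consider random walks on $\mathbb R$ whose i.i.d. steps have the probability density $$u\longmapsto \frac{3}{2\pi}\,\frac{e^{\frac52(u-\ln c)}}{1+e^{3(u-\ln c)}},\qquad u\in\mathbb R$$ (this is the walk formed by the logarithms of the outgoing velocities at the successive bounces of the Langevin process reflected at $0$ with elasticity coefficient $c$). Write $P_y$ for the law of the walk $(S_n)_{n\ge0}$ started from $S_0=y$, let $H_1-H_0 = S_{\tau}-S_0$ with $\tau=\inf\{n\ge1: S_n>S_0\}$ be its first strictly ascending ladder jump, and let $$m(dy)=\frac{P_0(H_1-H_0>y)}{E_0(H_1-H_0)}\,\mathbf 1_{y\ge0}\,dy$$ be the stationary law of the overshoot. For a sequence $\omega\in[-\infty,\infty)^{\mathbb Z}$ and $x\in\mathbb R$ let $T_x(\omega)=\inf\{n\in\mathbb Z:\omega_n>x\}$ and $\Theta_x(\omega)=(\omega_{n+T_x}-x)_{n\in\mathbb Z}$. A probability law on $[-\infty,\infty)^{\mathbb Z}$ under which almost surely $\lim_{n\to-\infty}\omega_n=-\infty$ and $\limsup_{n\to+\infty}\omega_n=+\infty$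 is called spatially stationary if its image under $\Theta_x$ is itself, for every $x\in\mathbb R$. There is a unique spatially stationary law $\mathbf P^1$ under which $(S_n)_{n\ge0}$ is the random walk whose starting position $S_0$ has law $m$ (the law of the spatially stationary random walk). For every $x\ge0$ the event $\{S_n>0\ \text{for all } n\ge1\}$ has positive probability under $P_{-x}$. Under $\mathbf P^1$, $S_0\in[0,\infty)$ almost surely, and conditionally on $S_0=x\ge0$ (that is, for almost every value $x$ of $S_0$, in the sense of regular conditional distributions) the sequence $(-S_{-n})_{n\ge0}$ has the law $P_{-x}\big(\,\cdot\mid S_n>0 \text{ for all } n\ge1\big)$ of the random walk started from $-x$ and conditioned to stay positive at times $n\ge1$. -/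

import Mathlib

open MeasureTheory ProbabilityTheory Filter Topology

noncomputable section

/-! ### The generic step of the walk -/

/-- The density of the logarithm of the ratio of two consecutive outgoing bounce velocities, when
the elasticity coefficient is `c`. -/
def stepDensity (c u : ℝ) : ℝ :=
  3 / (2 * Real.pi) *
    (Real.exp (5 / 2 * (u - Real.log c)) / (1 + Real.exp (3 * (u - Real.log c))))

/-- The step distribution of the walk. -/
def stepLaw (c : ℝ) : Measure ℝ :=
  volume.withDensity fun u => ENNReal.ofReal (stepDensity c u)

theorem stepAux_hasDerivAt (w : ℝ) :
    HasDerivAt (fun w : ℝ => 2 * Real.arctan (Real.exp (w / 2))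
        + 2 / 3 * Real.arctan (Real.exp (3 * w / 2)))
      (Real.exp (5 / 2 * w) / (1 + Real.exp (3 * w))
        + Real.exp (5 / 2 * (-w)) / (1 + Real.exp (3 * (-w)))) w := by
  have h1 : HasDerivAt (fun w : ℝ => Real.exp (w / 2)) (Real.exp (w / 2) * (1 / 2)) w :=
    ((hasDerivAt_id w).div_const 2).exp
  have h2 : HasDerivAt (fun w : ℝ => Real.exp (3 * w / 2)) (Real.exp (3 * w / 2) * (3 * 1 / 2)) w :=
    (((hasDerivAt_id w).const_mul 3).div_const 2).exp
  refine ((h1.arctan.const_mul 2).add (h2.arctan.const_mul (2 / 3))).congr_deriv ?_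
  obtain ⟨s, hs⟩ : ∃ s, s = Real.exp (w / 2) := ⟨_, rfl⟩
  have hs0 : 0 < s := hs ▸ Real.exp_pos _
  have e1 : Real.exp (5 / 2 * w) = s ^ 5 := by
    rw [hs, ← Real.exp_nat_mul]; congr 1; push_cast; ring
  have e2 : Real.exp (3 * w) = s ^ 6 := by
    rw [hs, ← Real.exp_nat_mul]; congr 1; push_cast; ring
  have e3 : Real.exp (5 / 2 * (-w)) = (s ^ 5)⁻¹ := by
    rw [← e1, ← Real.exp_neg]; congr 1; ring
  have e4 : Real.exp (3 * (-w)) = (s ^ 6)⁻¹ := by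
    rw [← e2, ← Real.exp_neg]; congr 1; ring
  have e5 : Real.exp (3 * w / 2) = s ^ 3 := by
    rw [hs, ← Real.exp_nat_mul]; congr 1; push_cast; ring
  rw [e1, e2, e3, e4, e5, ← hs]
  have a1 : 1 + s ^ 6 ≠ 0 := by positivity
  have a2 : 1 + s ^ 2 ≠ 0 := by positivity
  have a3 : 1 + (s ^ 3) ^ 2 ≠ 0 := by positivity
  field_simp
  ring

theorem stepAux_lintegral :
    ∫⁻ w : ℝ, ENNReal.ofReal (Real.exp (5 / 2 * w) / (1 + Real.exp (3 * w)))
      = ENNReal.ofReal (2 * Real.pi / 3) := by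
  set f : ℝ → ℝ := fun w => Real.exp (5 / 2 * w) / (1 + Real.exp (3 * w)) with hf
  have hf0 : ∀ w, 0 ≤ f w := fun w => by positivity
  have hfc : Continuous f := by
    refine Continuous.div (by fun_prop) (by fun_prop) fun w => by positivity
  set F : ℝ → ℝ := fun w => 2 * Real.arctan (Real.exp (w / 2))
        + 2 / 3 * Real.arctan (Real.exp (3 * w / 2)) with hF
  have hd : ∀ w, HasDerivAt F (f w + f (-w)) w := stepAux_hasDerivAt
  have htop : Tendsto F atTop (𝓝 (2 * (Real.pi / 2) + 2 / 3 * (Real.pi / 2))) := by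
    have ha := (tendsto_nhds_of_tendsto_nhdsWithin Real.tendsto_arctan_atTop)
    refine Tendsto.add (Tendsto.const_mul _ (ha.comp (Real.tendsto_exp_atTop.comp ?_)))
      (Tendsto.const_mul _ (ha.comp (Real.tendsto_exp_atTop.comp ?_)))
    · exact tendsto_id.atTop_div_const (by norm_num)
    · exact (tendsto_id.const_mul_atTop (by norm_num)).atTop_div_const (by norm_num)
  have hbot : Tendsto F atBot (𝓝 (2 * 0 + 2 / 3 * 0)) := by
    have ha : Tendsto Real.arctan (𝓝 0) (𝓝 0) := by
      simpa using Real.continuous_arctan.tendsto 0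
    refine Tendsto.add (Tendsto.const_mul _ (ha.comp (Real.tendsto_exp_atBot.comp ?_)))
      (Tendsto.const_mul _ (ha.comp (Real.tendsto_exp_atBot.comp ?_)))
    · exact tendsto_id.atBot_div_const (by norm_num)
    · exact (tendsto_id.const_mul_atBot (by norm_num)).atBot_div_const (by norm_num)
  have hg0 : ∀ w, 0 ≤ f w + f (-w) := fun w => add_nonneg (hf0 _) (hf0 _)
  have hint : Integrable fun w => f w + f (-w) := by
    have hI : IntegrableOn (fun w => f w + f (-w)) (Set.Ioi 0) :=
      integrableOn_Ioi_deriv_of_nonneg' (fun w _ => hd w) (fun w _ => hg0 w) htop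
    have hI' : IntegrableOn (fun w => f w + f (-w)) (Set.Iio 0) := by
      have h := ((integrable_indicator_iff measurableSet_Ioi).2 hI).comp_neg
      refine (integrable_indicator_iff measurableSet_Iio).1 (h.congr (Eventually.of_forall fun w => ?_))
      simp [Set.indicator, add_comm]
    rw [← integrableOn_univ, ← Set.Iio_union_Ici (a := (0 : ℝ))]
    exact hI'.union (integrableOn_Ici_iff_integrableOn_Ioi (by finiteness) |>.2 hI)
  have hfi : Integrable f := by
    refine hint.mono' hfc.aestronglyMeasurable (Eventually.of_forall fun w => ?_)
    rw [Real.norm_of_nonneg (hf0 w)]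
    exact le_add_of_nonneg_right (hf0 _)
  have hval := integral_of_hasDerivAt_of_tendsto hd hint hbot htop
  rw [integral_add hfi hfi.comp_neg, integral_neg_eq_self f volume] at hval
  rw [← ofReal_integral_eq_lintegral_ofReal hfi (Eventually.of_forall hf0)]
  congr 1
  linarith

instance (c : ℝ) : IsProbabilityMeasure (stepLaw c) := by
  constructor
  rw [stepLaw, withDensity_apply _ MeasurableSet.univ, Measure.restrict_univ]
  have hK : 0 ≤ 3 / (2 * Real.pi) := by positivity
  simp only [stepDensity, ENNReal.ofReal_mul hK]
  rw [lintegral_const_mul' _ _ ENNReal.ofReal_ne_top,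
    lintegral_sub_right_eq_self
      (fun w : ℝ => ENNReal.ofReal (Real.exp (5 / 2 * w) / (1 + Real.exp (3 * w))))
      (Real.log c), stepAux_lintegral, ← ENNReal.ofReal_mul hK]
  rw [← ENNReal.ofReal_one]
  congr 1
  field_simp

/-! ### Random walks indexed by the nonnegative integers -/

/-- The law of the random walk `(S_n)_{n ≥ 0}` whose starting position has law `ν` and whose steps
are i.i.d. with law `stepLaw c`, independent of the starting position. -/
def walkLaw (c : ℝ) (ν : Measure ℝ) : Measure (ℕ → ℝ) :=
  (ν.prod (Measure.infinitePi fun _ : ℕ => stepLaw c)).map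
    fun p n => p.1 + ∑ i ∈ Finset.range n, p.2 i

/-- The event that the walk is positive at all times `n ≥ 1`. -/
def staysPositive : Set (ℕ → ℝ) := {s | ∀ n, 1 ≤ n → 0 < s n}

/-- The law of the walk started from `y` and conditioned to stay positive at times `n ≥ 1`. -/
def walkCondPositive (c y : ℝ) : Measure (ℕ → ℝ) :=
  ProbabilityTheory.cond (walkLaw c (Measure.dirac y)) staysPositive

/-- The first jump `H_1 - H_0` of the strictly ascending ladder height process: the increment of
the walk up to the first time `n ≥ 1` such that `S_n > S_0`. -/
def firstLadderJump (s : ℕ → ℝ) : ℝ := s (sInf {n | 0 < n ∧ s 0 < s n}) - s 0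

/-- The mean of the first ladder jump. -/
def ladderMean (c : ℝ) : ENNReal :=
  ∫⁻ s, ENNReal.ofReal (firstLadderJump s) ∂walkLaw c (Measure.dirac 0)

/-- The stationary law of the overshoot, of density `P(H_1 - H_0 > y) / E(H_1 - H_0)` on
the half-line `y ≥ 0`. -/
def overshootLaw (c : ℝ) : Measure ℝ :=
  (volume.restrict (Set.Ici 0)).withDensity fun y =>
    (ladderMean c)⁻¹ * walkLaw c (Measure.dirac 0) {s | y < firstLadderJump s}

/-! ### Two-sided sequences and spatial stationarity -/

/-- The hitting time `T_x = inf {n ∈ ℤ : ω_n > x}`. -/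
def hitTime (x : ℝ) (ω : ℤ → EReal) : ℤ := sInf {n | (x : EReal) < ω n}

/-- The spatial translation operator. -/
def spatialShift (x : ℝ) (ω : ℤ → EReal) : ℤ → EReal := fun n => ω (n + hitTime x ω) - (x : EReal)

/-- The projection `ω ↦ ω⁺`, which replaces the entries of negative index by `-∞`. -/
def plusPart (ω : ℤ → EReal) : ℤ → EReal := fun n => if n < 0 then ⊥ else ω n

/-- A one-sided real sequence, completed by `-∞` at negative indices. -/
def extendBot (s : ℕ → ℝ) : ℤ → EReal := fun n => if n < 0 then ⊥ else (s n.toNat : EReal)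

/-- `P` is the law of the spatially stationary random walk: a law on sequences with values
in `[-∞, ∞)`, tending to `-∞` at `-∞` and with upper limit `+∞` at `+∞` (so that the hitting times
are finite), invariant under all spatial translations, and whose projection on nonnegative times is
the random walk started from the stationary law of the overshoot. -/
structure IsSpatiallyStationaryWalk (c : ℝ) (P : Measure (ℤ → EReal)) : Prop where
  lt_top : ∀ᵐ ω ∂P, ∀ n, ω n < ⊤
  tendsto_bot : ∀ᵐ ω ∂P, Tendsto ω atBot (𝓝 ⊥)
  limsup_top : ∀ᵐ ω ∂P, limsup ω atTop = ⊤
  stationary : ∀ x : ℝ, P.map (spatialShift x) = P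
  plus : P.map plusPart = (walkLaw c (overshootLaw c)).map extendBot

end

noncomputable section

/-! ### Partial sums of one-sided and two-sided sequences of increments -/

/-- The law of a family of independent increments with common law `μ`. -/
abbrev iidLaw (ι : Type*) (μ : Measure ℝ) [IsProbabilityMeasure μ] : Measure (ι → ℝ) :=
  Measure.infinitePi fun _ : ι => μ

/-- The partial sums of a sequence of increments. -/
def partialSum (a : ℕ → ℝ) (n : ℕ) : ℝ := ∑ i ∈ Finset.range n, a i

/-- The increments at nonnegative times. -/
def futureSteps (ξ : ℤ → ℝ) : ℕ → ℝ := fun n => ξ n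

/-- The increments at negative times, in reversed order. -/
def pastSteps (ξ : ℤ → ℝ) : ℕ → ℝ := fun n => ξ (-(n : ℤ) - 1)

/-- The increments seen from time `k`. -/
def shiftSteps (k : ℤ) (ξ : ℤ → ℝ) : ℤ → ℝ := fun n => ξ (n + k)

/-- The two-sided walk with increments `ξ` that vanishes at time `0`. -/
def twoSidedSum (ξ : ℤ → ℝ) : ℤ → ℝ
  | Int.ofNat n => partialSum (futureSteps ξ) n
  | Int.negSucc n => -partialSum (pastSteps ξ) (n + 1)

@[simp] theorem partialSum_zero (a : ℕ → ℝ) : partialSum a 0 = 0 := by simp [partialSum]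

theorem partialSum_succ (a : ℕ → ℝ) (n : ℕ) : partialSum a (n + 1) = partialSum a n + a n :=
  Finset.sum_range_succ _ _

@[fun_prop] theorem measurable_partialSum (n : ℕ) : Measurable fun a => partialSum a n := by
  unfold partialSum; fun_prop

@[simp] theorem twoSidedSum_natCast (ξ : ℤ → ℝ) (n : ℕ) :
    twoSidedSum ξ n = partialSum (futureSteps ξ) n := rfl

@[simp] theorem twoSidedSum_neg_natCast (ξ : ℤ → ℝ) (n : ℕ) :
    twoSidedSum ξ (-n) = -partialSum (pastSteps ξ) n := by
  cases n with
  | zero => simpa using twoSidedSum_natCast ξ 0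
  | succ n => rfl

@[simp] theorem twoSidedSum_zero (ξ : ℤ → ℝ) : twoSidedSum ξ 0 = 0 := by
  simpa using twoSidedSum_natCast ξ 0

@[fun_prop] theorem measurable_futureSteps : Measurable futureSteps := by
  unfold futureSteps; fun_prop

@[fun_prop] theorem measurable_pastSteps : Measurable pastSteps := by
  unfold pastSteps; fun_prop

@[fun_prop] theorem measurable_shiftSteps (k : ℤ) : Measurable (shiftSteps k) := by
  unfold shiftSteps; fun_prop

@[fun_prop] theorem measurable_twoSidedSum (n : ℤ) : Measurable fun ξ => twoSidedSum ξ n := by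
  obtain ⟨n, rfl | rfl⟩ := n.eq_nat_or_neg <;> simp only [twoSidedSum_natCast,
    twoSidedSum_neg_natCast] <;> fun_prop

theorem twoSidedSum_add_one (ξ : ℤ → ℝ) (n : ℤ) :
    twoSidedSum ξ (n + 1) = twoSidedSum ξ n + ξ n := by
  obtain ⟨n, rfl | rfl⟩ := n.eq_nat_or_neg
  · rw [← Nat.cast_succ, twoSidedSum_natCast, twoSidedSum_natCast, partialSum_succ]; rfl
  · cases n with
    | zero => simpa [partialSum, futureSteps] using twoSidedSum_natCast ξ 1
    | succ n =>
      have h : -((n + 1 : ℕ) : ℤ) + 1 = -(n : ℤ) := by push_cast; ring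
      rw [h, twoSidedSum_neg_natCast, twoSidedSum_neg_natCast, partialSum_succ]
      have h' : pastSteps ξ n = ξ (-((n + 1 : ℕ) : ℤ)) := by
        simp only [pastSteps]; congr 1; push_cast; ring
      rw [h']; ring

theorem twoSidedSum_add (ξ : ℤ → ℝ) (k n : ℤ) :
    twoSidedSum ξ (n + k) = twoSidedSum ξ k + twoSidedSum (shiftSteps k ξ) n := by
  induction n using Int.induction_on with
  | zero => simp
  | succ n ih =>
    rw [add_right_comm, twoSidedSum_add_one, ih, twoSidedSum_add_one, shiftSteps, add_assoc]
  | pred n ih =>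
    have h1 := twoSidedSum_add_one ξ (-(n : ℤ) - 1 + k)
    have h2 := twoSidedSum_add_one (shiftSteps k ξ) (-(n : ℤ) - 1)
    rw [show -(n : ℤ) - 1 + k + 1 = -n + k by ring, ih] at h1
    rw [sub_add_cancel] at h2
    simp only [shiftSteps] at h1 h2 ⊢
    linarith

section Laws

variable (μ : Measure ℝ) [IsProbabilityMeasure μ]

theorem measurePreserving_shiftSteps (k : ℤ) :
    MeasurePreserving (shiftSteps k) (iidLaw ℤ μ) (iidLaw ℤ μ) :=
  ⟨by fun_prop, Measure.map_infinitePi_infinitePi_of_inj (P := fun _ : ℤ => μ)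
    (add_left_injective k)⟩

/-- The future and the past increments are independent. -/
theorem measurePreserving_future_past :
    MeasurePreserving (fun ξ => (futureSteps ξ, pastSteps ξ)) (iidLaw ℤ μ)
      ((iidLaw ℕ μ).prod (iidLaw ℕ μ)) := by
  refine ⟨by fun_prop, ?_⟩
  let e : Fin 2 × ℕ → ℤ := fun p => if p.1 = 0 then p.2 else -(p.2 : ℤ) - 1
  have he : Function.Injective e := by
    rintro ⟨i, m⟩ ⟨j, n⟩ h
    fin_cases i <;> fin_cases j <;> simp [e] at h ⊢ <;> omega
  have h1 := Measure.map_infinitePi_infinitePi_of_inj (P := fun _ : ℤ => μ) he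
  have h2 := Measure.infinitePi_map_curry (ι := Fin 2) (κ := ℕ) (X := ℝ) (fun _ _ => μ)
  rw [Measure.infinitePi_eq_pi (μ := fun _ : Fin 2 => iidLaw ℕ μ)] at h2
  have h3 := (measurePreserving_finTwoArrow (iidLaw ℕ μ)).map_eq
  rw [← h3, ← h2, ← h1, Measure.map_map (by fun_prop) (by fun_prop),
    Measure.map_map (by fun_prop) (by fun_prop)]
  rfl

theorem measurePreserving_futureSteps :
    MeasurePreserving futureSteps (iidLaw ℤ μ) (iidLaw ℕ μ) :=
  measurePreserving_fst.comp (measurePreserving_future_past μ)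

theorem measurePreserving_pastSteps :
    MeasurePreserving pastSteps (iidLaw ℤ μ) (iidLaw ℕ μ) :=
  measurePreserving_snd.comp (measurePreserving_future_past μ)

variable {μ}

theorem tendsto_partialSum_atTop (hint : Integrable id μ) (hpos : 0 < ∫ x, x ∂μ) :
    ∀ᵐ a ∂iidLaw ℕ μ, Tendsto (partialSum a) atTop atTop := by
  have hm : ∀ i : ℕ, MeasurePreserving (Function.eval i) (iidLaw ℕ μ) μ :=
    fun i => measurePreserving_eval_infinitePi _ i
  have hindep : iIndepFun (fun (i : ℕ) (a : ℕ → ℝ) => a i) (iidLaw ℕ μ) :=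
    iIndepFun_infinitePi (X := fun _ x => x) fun _ => measurable_id
  have hmean : ∫ a, Function.eval 0 a ∂iidLaw ℕ μ = ∫ x, x ∂μ :=
    integral_map (μ := iidLaw ℕ μ) (φ := Function.eval 0) (f := fun x => x)
      (hm 0).measurable.aemeasurable (by fun_prop) |>.symm.trans (by rw [(hm 0).map_eq])
  filter_upwards [strong_law_ae_real (μ := iidLaw ℕ μ) (fun (i : ℕ) (a : ℕ → ℝ) => a i)
    ((hm 0).integrable_comp_of_integrable hint) (fun i j hij => hindep.indepFun hij)
    fun i => ⟨(measurable_pi_apply _).aemeasurable, (measurable_pi_apply _).aemeasurable, (hm i).map_eq.trans (hm 0).map_eq.symm⟩] with a ha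
  have hlim : Tendsto (fun n : ℕ => (∑ i ∈ Finset.range n, a i) / n) atTop (𝓝 (∫ x, x ∂μ)) := by
    rw [← hmean]; exact ha
  refine (Tendsto.atTop_mul_pos hpos tendsto_natCast_atTop_atTop hlim).congr' ?_
  filter_upwards [eventually_gt_atTop 0] with n hn
  have : (n : ℝ) ≠ 0 := by positivity
  simp only [partialSum]
  field_simp

theorem tendsto_twoSidedSum (hint : Integrable id μ) (hpos : 0 < ∫ x, x ∂μ) :
    ∀ᵐ ξ ∂iidLaw ℤ μ, Tendsto (twoSidedSum ξ) atTop atTop ∧ Tendsto (twoSidedSum ξ) atBot atBot := by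
  filter_upwards [(measurePreserving_futureSteps μ).quasiMeasurePreserving.ae
      (tendsto_partialSum_atTop hint hpos),
    (measurePreserving_pastSteps μ).quasiMeasurePreserving.ae
      (tendsto_partialSum_atTop hint hpos)] with ξ h1 h2
  constructor
  · rw [← Nat.map_cast_int_atTop, tendsto_map'_iff]
    exact h1
  · have h : Tendsto (fun n : ℤ => -twoSidedSum ξ (-n)) atTop atTop := by
      rw [← Nat.map_cast_int_atTop, tendsto_map'_iff]
      exact h2.congr fun n => by simp
    exact (tendsto_neg_atTop_atBot.comp (h.comp tendsto_neg_atBot_atTop)).congr fun n => by simp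

end Laws

/-! ### Duality between the overall minimum and the first ladder jump -/

theorem measure_eq_tsum_inter {Ω ι : Type*} [MeasurableSpace Ω] [Countable ι] {P : Measure Ω}
    {C : ι → Set Ω} (hC : ∀ i, MeasurableSet (C i)) (hd : Pairwise (Function.onFun Disjoint C))
    (hcov : ∀ᵐ w ∂P, ∃ i, w ∈ C i) {B : Set Ω} (hB : MeasurableSet B) :
    P B = ∑' i, P (B ∩ C i) := by
  rw [← measure_iUnion (fun i j hij => (hd hij).mono Set.inter_subset_right Set.inter_subset_right)
    fun i => hB.inter (hC i), ← Set.inter_iUnion]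
  refine measure_congr ?_
  filter_upwards [hcov] with w hw
  simp only [eq_iff_iff]
  change w ∈ B ↔ w ∈ B ∩ ⋃ i, C i
  simpa using fun _ => hw

theorem exists_last_argmin {f : ℕ → ℝ} (hf : Tendsto f atTop atTop) :
    ∃ n, (∀ j ≤ n, f n ≤ f j) ∧ ∀ j, n < j → f n < f j := by
  obtain ⟨m, hm⟩ : ∃ m, ∀ j, f m ≤ f j := by
    rw [← Nat.cofinite_eq_atTop] at hf
    exact hf.exists_forall_le
  obtain ⟨N, hN⟩ := eventually_atTop.1 (hf.eventually_gt_atTop (f m))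
  have hex : ∃ n, ∀ j, n < j → f m < f j := ⟨N, fun j hj => hN j hj.le⟩
  classical
  have hspec := Nat.find_spec hex
  have hle : f (Nat.find hex) ≤ f m := by
    by_contra! h
    rcases Nat.eq_zero_or_pos (Nat.find hex) with h0 | h0
    · rcases Nat.eq_zero_or_pos m with rfl | hm0
      · rw [h0] at h; exact lt_irrefl _ h
      · exact lt_irrefl _ (hspec m (h0 ▸ hm0))
    · refine Nat.find_min hex (Nat.sub_lt h0 one_pos) fun j hj => ?_
      rcases (show Nat.find hex ≤ j by omega).eq_or_lt with rfl | hj'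
      · exact h
      · exact hspec j hj'
  exact ⟨Nat.find hex, fun j _ => hle.trans (hm j), fun j hj => hle.trans_lt (hspec j hj)⟩

/-- The increments for which all partial sums of positive length exceed `y`. -/
def staysAbove (y : ℝ) : Set (ℕ → ℝ) := {a | ∀ n, 1 ≤ n → y < partialSum a n}

/-- The increments for which the walk enters the positive half-line at time `n`, above `y`. -/
def ladderAt (y : ℝ) (n : ℕ) : Set (ℕ → ℝ) :=
  {a | (∀ j, 1 ≤ j → j < n → partialSum a j ≤ 0) ∧ y < partialSum a n}

/-- The increments for which the walk enters the positive half-line above `y`. -/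
def ladderAbove (y : ℝ) : Set (ℕ → ℝ) := ⋃ n : ℕ, ladderAt y (n + 1)

/-- The two-sided increments for which `n` is the last time among the positive ones at which the
walk attains its minimum over these. -/
def lastArgmin (n : ℕ) : Set (ℤ → ℝ) :=
  {ξ | (∀ j : ℕ, 1 ≤ j → j ≤ n → twoSidedSum ξ n ≤ twoSidedSum ξ j) ∧
    ∀ j : ℕ, n < j → twoSidedSum ξ n < twoSidedSum ξ j}

theorem measurableSet_staysAbove (y : ℝ) : MeasurableSet (staysAbove y) := by
  unfold staysAbove
  simp only [Set.ofPred_forall]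
  exact .iInter fun n => .iInter fun _ => measurableSet_lt measurable_const (by fun_prop)

theorem measurableSet_ladderAt (y : ℝ) (n : ℕ) : MeasurableSet (ladderAt y n) := by
  unfold ladderAt
  simp only [Set.ofPred_and, Set.ofPred_forall]
  exact .inter (.iInter fun n => .iInter fun _ => .iInter fun _ =>
    measurableSet_le (by fun_prop) measurable_const) (measurableSet_lt measurable_const (by fun_prop))

theorem measurableSet_ladderAbove (y : ℝ) : MeasurableSet (ladderAbove y) :=
  .iUnion fun _ => measurableSet_ladderAt _ _

theorem measurableSet_lastArgmin (n : ℕ) : MeasurableSet (lastArgmin n) := by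
  unfold lastArgmin
  simp only [Set.ofPred_and, Set.ofPred_forall]
  exact .inter (.iInter fun n => .iInter fun _ => .iInter fun _ =>
    measurableSet_le (by fun_prop) (by fun_prop)) (.iInter fun n => .iInter fun _ =>
      measurableSet_lt (by fun_prop) (by fun_prop))

theorem pairwise_disjoint_lastArgmin :
    Pairwise (Function.onFun Disjoint fun n : ℕ => lastArgmin (n + 1)) := by
  refine (pairwise_disjoint_on _).2 fun m n hmn => Set.disjoint_left.2 fun ξ h1 h2 => ?_
  exact (h2.1 (m + 1) (by omega) (by omega)).not_gt (h1.2 (n + 1) (by omega))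

theorem pairwise_disjoint_ladderAt {y : ℝ} (hy : 0 ≤ y) :
    Pairwise (Function.onFun Disjoint fun n : ℕ => ladderAt y (n + 1)) := by
  refine (pairwise_disjoint_on _).2 fun m n hmn => Set.disjoint_left.2 fun ξ h1 h2 => ?_
  exact ((h2.1 (m + 1) (by omega) (by omega)).trans hy).not_gt h1.2

theorem staysAbove_inter_lastArgmin {y : ℝ} {n : ℕ} (hn : 1 ≤ n) :
    futureSteps ⁻¹' staysAbove y ∩ lastArgmin n =
      shiftSteps n ⁻¹' (futureSteps ⁻¹' staysAbove 0 ∩ pastSteps ⁻¹' ladderAt y n) := by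
  ext ξ
  have hf : ∀ j : ℕ, partialSum (futureSteps (shiftSteps n ξ)) j =
      twoSidedSum ξ (j + n : ℕ) - twoSidedSum ξ n := fun j => by
    rw [Nat.cast_add, twoSidedSum_add]
    simp only [twoSidedSum_natCast]; ring
  have hp : ∀ j : ℕ, j ≤ n → partialSum (pastSteps (shiftSteps n ξ)) j =
      twoSidedSum ξ n - twoSidedSum ξ (n - j : ℕ) := fun j hj => by
    rw [Nat.cast_sub hj, show (n : ℤ) - j = -j + n by ring, twoSidedSum_add, twoSidedSum_neg_natCast]; ring
  simp only [Set.mem_inter_iff, Set.mem_preimage, staysAbove, ladderAt, lastArgmin,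
    Set.mem_ofPred_eq, hf, ← twoSidedSum_natCast ξ]
  rw [hp n le_rfl, Nat.sub_self, Nat.cast_zero, twoSidedSum_zero, sub_zero]
  constructor
  · rintro ⟨h1, h2, h3⟩
    refine ⟨fun j hj => sub_pos.2 (h3 _ (by omega)), fun j hj hjn => ?_, h1 n hn⟩
    rw [hp j hjn.le]
    exact sub_nonpos.2 (h2 _ (by omega) (by omega))
  · rintro ⟨h1, h2, h3⟩
    have h4 : ∀ j : ℕ, n < j → twoSidedSum ξ n < twoSidedSum ξ j := fun j hj => by
      have := h1 (j - n) (by omega)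
      rw [Nat.sub_add_cancel hj.le] at this
      linarith
    have h5 : ∀ j : ℕ, 1 ≤ j → j ≤ n → twoSidedSum ξ n ≤ twoSidedSum ξ j := fun j hj hjn => by
      rcases hjn.eq_or_lt with rfl | hlt
      · exact le_rfl
      · have := h2 (n - j) (by omega) (by omega)
        rw [hp _ (by omega), Nat.sub_sub_self hjn] at this
        linarith
    refine ⟨fun j hj => ?_, h5, h4⟩
    rcases le_or_gt j n with h | h
    · exact h3.trans_le (h5 j hj h)
    · exact h3.trans (h4 j h)

section Laws

variable {μ : Measure ℝ} [IsProbabilityMeasure μ]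

theorem exists_mem_lastArgmin (hint : Integrable id μ) (hpos : 0 < ∫ x, x ∂μ) :
    ∀ᵐ ξ ∂iidLaw ℤ μ, ∃ n : ℕ, ξ ∈ lastArgmin (n + 1) := by
  filter_upwards [tendsto_twoSidedSum hint hpos] with ξ h
  have h1 : Tendsto (fun n : ℕ => twoSidedSum ξ (n + 1 : ℕ)) atTop atTop :=
    h.1.comp (tendsto_natCast_atTop_atTop.comp (tendsto_add_atTop_nat 1))
  obtain ⟨n, hn1, hn2⟩ := exists_last_argmin h1
  refine ⟨n, fun j hj hjn => ?_, fun j hj => ?_⟩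
  · have := hn1 (j - 1) (by omega)
    rwa [Nat.sub_add_cancel hj] at this
  · have := hn2 (j - 1) (by omega)
    rwa [Nat.sub_add_cancel (by omega)] at this

/-- The tail of the minimum of the walk over positive times is proportional to the tail of the
first ladder jump. -/
theorem iidLaw_staysAbove (hint : Integrable id μ) (hpos : 0 < ∫ x, x ∂μ) {y : ℝ} (hy : 0 ≤ y) :
    iidLaw ℕ μ (staysAbove y) = iidLaw ℕ μ (staysAbove 0) * iidLaw ℕ μ (ladderAbove y) := by
  have hF : MeasurableSet (futureSteps ⁻¹' staysAbove y) :=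
    measurable_futureSteps (measurableSet_staysAbove y)
  have hF0 : MeasurableSet (futureSteps ⁻¹' staysAbove 0) :=
    measurable_futureSteps (measurableSet_staysAbove 0)
  have hP : ∀ n, MeasurableSet (pastSteps ⁻¹' ladderAt y n) := fun n =>
    measurable_pastSteps (measurableSet_ladderAt y n)
  rw [← (measurePreserving_futureSteps μ).measure_preimage
      (measurableSet_staysAbove y).nullMeasurableSet,
    measure_eq_tsum_inter (fun n => measurableSet_lastArgmin (n + 1)) pairwise_disjoint_lastArgmin
      (exists_mem_lastArgmin hint hpos) hF, ← Measure.prod_prod,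
    ← (measurePreserving_future_past μ).measure_preimage
      ((measurableSet_staysAbove 0).prod (measurableSet_ladderAbove y)).nullMeasurableSet]
  have : (fun ξ => (futureSteps ξ, pastSteps ξ)) ⁻¹' (staysAbove 0 ×ˢ ladderAbove y) =
      ⋃ n : ℕ, (futureSteps ⁻¹' staysAbove 0 ∩ pastSteps ⁻¹' ladderAt y (n + 1)) := by
    ext ξ; simp [ladderAbove]
  rw [this, measure_iUnion _ fun n => hF0.inter (hP _)]
  · refine tsum_congr fun n => ?_
    rw [staysAbove_inter_lastArgmin (by omega),
      (measurePreserving_shiftSteps μ _).measure_preimage (hF0.inter (hP _)).nullMeasurableSet]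
  · exact fun i j hij => ((pairwise_disjoint_ladderAt hy hij).preimage _).mono
      Set.inter_subset_right Set.inter_subset_right

theorem iidLaw_staysAbove_zero_pos (hint : Integrable id μ) (hpos : 0 < ∫ x, x ∂μ) :
    0 < iidLaw ℕ μ (staysAbove 0) := by
  refine pos_iff_ne_zero.2 fun h0 => ?_
  have h := measure_eq_tsum_inter (fun n => measurableSet_lastArgmin (n + 1))
    pairwise_disjoint_lastArgmin (exists_mem_lastArgmin hint hpos) MeasurableSet.univ
  rw [measure_univ] at h
  refine one_ne_zero (h.trans (ENNReal.tsum_eq_zero.2 fun n => ?_))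
  have hF0 : MeasurableSet (futureSteps ⁻¹' staysAbove 0) :=
    measurable_futureSteps (measurableSet_staysAbove 0)
  refine measure_mono_null (t := shiftSteps (n + 1 : ℕ) ⁻¹' (futureSteps ⁻¹' staysAbove 0))
    (fun ξ hξ => ?_) ?_
  · intro j hj
    have h2 := hξ.2.2 (j + (n + 1)) (by omega)
    have h3 := twoSidedSum_add ξ (n + 1 : ℕ) j
    rw [← Nat.cast_add] at h3
    rw [← twoSidedSum_natCast]
    linarith
  · rw [(measurePreserving_shiftSteps μ _).measure_preimage hF0.nullMeasurableSet,
      (measurePreserving_futureSteps μ).measure_preimage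
        (measurableSet_staysAbove 0).nullMeasurableSet, h0]

end Laws

/-! ### Hitting times and spatial shifts of two-sided sequences -/

/-- The sequences that exceed `x` for the first time at time `k`. -/
def firstHit (x : ℝ) (k : ℤ) : Set (ℤ → EReal) := {ω | (x : EReal) < ω k ∧ ∀ n < k, ω n ≤ x}

theorem measurableSet_firstHit (x : ℝ) (k : ℤ) : MeasurableSet (firstHit x k) := by
  unfold firstHit
  simp only [Set.ofPred_and, Set.ofPred_forall]
  exact .inter (measurableSet_lt measurable_const (by fun_prop)) (.iInter fun n => .iInter fun _ =>
    measurableSet_le (by fun_prop) measurable_const)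

theorem hitTime_eq_of_mem_firstHit {x : ℝ} {k : ℤ} {ω : ℤ → EReal} (h : ω ∈ firstHit x k) :
    hitTime x ω = k :=
  IsLeast.csInf_eq ⟨h.1, fun n hn => not_lt.1 fun hnk => (h.2 n hnk).not_gt hn⟩

theorem exists_mem_firstHit {x : ℝ} {ω : ℤ → EReal} (hne : ∃ n, (x : EReal) < ω n)
    (hb : ∃ b, ∀ n, (x : EReal) < ω n → b ≤ n) : ∃ k, ω ∈ firstHit x k := by
  obtain ⟨k, hk, hmin⟩ := Int.exists_least_of_bdd hb hne
  exact ⟨k, hk, fun n hn => not_lt.1 fun h => (hmin n h).not_gt hn⟩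

theorem measurable_hitTime (x : ℝ) : Measurable (hitTime x) := by
  refine measurable_to_countable' fun k => ?_
  have hU : MeasurableSet (⋃ j, firstHit x j) := .iUnion fun j => measurableSet_firstHit x j
  have h0 : ∀ ω ∉ ⋃ j, firstHit x j, hitTime x ω = 0 := fun ω hω => by
    by_cases hne : ∃ n, (x : EReal) < ω n
    · refine Int.csInf_of_not_bddBelow fun hb => hω ?_
      obtain ⟨b, hb⟩ := hb
      exact Set.mem_iUnion.2 (exists_mem_firstHit hne ⟨b, fun n hn => hb hn⟩)
    · have : {n | (x : EReal) < ω n} = ∅ := Set.eq_empty_iff_forall_notMem.2 fun n hn => hne ⟨n, hn⟩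
      rw [hitTime, this, Int.csInf_empty]
  by_cases hk : k = 0
  · convert! (measurableSet_firstHit x k).union hU.compl using 1
    ext ω
    by_cases hω : ω ∈ ⋃ j, firstHit x j
    · obtain ⟨j, hj⟩ := Set.mem_iUnion.1 hω
      have hT := hitTime_eq_of_mem_firstHit hj
      simp only [Set.mem_preimage, Set.mem_singleton_iff, Set.mem_union, Set.mem_compl_iff, hω,
        not_true, or_false]
      exact ⟨fun h => by rwa [← h, hT], hitTime_eq_of_mem_firstHit⟩
    · rw [Set.mem_preimage, h0 ω hω]
      exact iff_of_true hk.symm (Or.inr hω)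
  · convert! measurableSet_firstHit x k using 1
    ext ω
    refine ⟨fun h => ?_, hitTime_eq_of_mem_firstHit⟩
    by_cases hω : ω ∈ ⋃ j, firstHit x j
    · obtain ⟨j, hj⟩ := Set.mem_iUnion.1 hω
      have hT := hitTime_eq_of_mem_firstHit hj
      rw [Set.mem_preimage, Set.mem_singleton_iff] at h
      rwa [← h, hT]
    · exact absurd (h.symm.trans (h0 ω hω)) hk

theorem EReal.measurable_sub_coe (x : ℝ) : Measurable fun e : EReal => e - x :=
  Monotone.measurable fun _ _ h => EReal.sub_le_sub h le_rfl

@[fun_prop] theorem measurable_spatialShift (x : ℝ) : Measurable (spatialShift x) := by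
  refine measurable_pi_lambda _ fun n => (EReal.measurable_sub_coe x).comp ?_
  have h : Measurable fun p : (ℤ → EReal) × ℤ => p.1 (n + p.2) :=
    measurable_from_prod_countable_left fun k => measurable_pi_apply (n + k)
  exact h.comp (measurable_id.prodMk (measurable_hitTime x))

/-! ### The two-sided walk started from Lebesgue measure -/

/-- The path with position `w.1` at time `0` and increments `w.2`. -/
def walkPath (w : ℝ × (ℤ → ℝ)) : ℤ → EReal := fun n => ((w.1 + twoSidedSum w.2 n : ℝ) : EReal)

/-- The starting position and the increments seen from time `k`. -/
def timeShift (k : ℤ) (w : ℝ × (ℤ → ℝ)) : ℝ × (ℤ → ℝ) :=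
  (w.1 + twoSidedSum w.2 k, shiftSteps k w.2)

/-- Starting position and increments of a two-sided walk that exceeds `x` for the first time at
time `0`. -/
def crossesAtZero (x : ℝ) : Set (ℝ × (ℤ → ℝ)) :=
  {w | x < w.1 ∧ ∀ n : ℤ, n < 0 → w.1 + twoSidedSum w.2 n ≤ x}

@[fun_prop] theorem measurable_walkPath : Measurable walkPath := by
  unfold walkPath
  refine measurable_pi_lambda _ fun n => measurable_coe_real_ereal.comp (by fun_prop)

@[fun_prop] theorem measurable_timeShift (k : ℤ) : Measurable (timeShift k) := by
  unfold timeShift; fun_prop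

theorem measurableSet_crossesAtZero (x : ℝ) : MeasurableSet (crossesAtZero x) := by
  unfold crossesAtZero
  simp only [Set.ofPred_and, Set.ofPred_forall]
  exact .inter (measurableSet_lt measurable_const (by fun_prop)) (.iInter fun n => .iInter fun _ =>
    measurableSet_le (by fun_prop) measurable_const)

theorem timeShift_neg_timeShift (k : ℤ) (w : ℝ × (ℤ → ℝ)) :
    timeShift k (timeShift (-k) w) = w := by
  refine Prod.ext ?_ ?_
  · have := twoSidedSum_add w.2 (-k) k
    rw [add_neg_cancel, twoSidedSum_zero] at this
    simp only [timeShift]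
    linarith
  · ext n; simp [timeShift, shiftSteps]

theorem walkPath_timeShift (k : ℤ) (w : ℝ × (ℤ → ℝ)) (n : ℤ) :
    walkPath (timeShift k w) n = walkPath w (n + k) := by
  simp only [walkPath, timeShift, twoSidedSum_add, add_assoc]

theorem timeShift_mem_crossesAtZero {x : ℝ} {k : ℤ} {w : ℝ × (ℤ → ℝ)} :
    timeShift k w ∈ crossesAtZero x ↔ walkPath w ∈ firstHit x k := by
  have h : ∀ n, w.1 + twoSidedSum w.2 k + twoSidedSum (shiftSteps k w.2) n =
      w.1 + twoSidedSum w.2 (n + k) := fun n => by rw [twoSidedSum_add]; ring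
  simp only [crossesAtZero, firstHit, Set.mem_ofPred_eq, walkPath, EReal.coe_lt_coe_iff,
    EReal.coe_le_coe_iff, timeShift, h]
  refine and_congr_right fun _ => ⟨fun H n hn => ?_, fun H n hn => H _ (by omega)⟩
  simpa using H (n - k) (by omega)

theorem spatialShift_walkPath {x : ℝ} {k : ℤ} {w : ℝ × (ℤ → ℝ)} (h : walkPath w ∈ firstHit x k) :
    spatialShift x (walkPath w) = walkPath (Prod.map (· - x) id (timeShift k w)) := by
  ext n
  rw [spatialShift, hitTime_eq_of_mem_firstHit h, ← walkPath_timeShift]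
  simp only [walkPath, Prod.map, id, ← EReal.coe_sub]
  congr 1; ring

theorem pairwise_disjoint_firstHit (x : ℝ) :
    Pairwise (Function.onFun Disjoint (firstHit x)) := fun _ _ hkl =>
  Set.disjoint_left.2 fun _ h1 h2 =>
    hkl ((hitTime_eq_of_mem_firstHit h1).symm.trans (hitTime_eq_of_mem_firstHit h2))

section Laws

variable (μ : Measure ℝ) [IsProbabilityMeasure μ]

/-- The two-sided walk whose position at time `0` has the Lebesgue measure as its law. -/
def lebesgueWalk : Measure (ℝ × (ℤ → ℝ)) := (volume : Measure ℝ).prod (iidLaw ℤ μ)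

instance : SFinite (lebesgueWalk μ) := by unfold lebesgueWalk; infer_instance

theorem measurePreserving_timeShift (k : ℤ) :
    MeasurePreserving (timeShift k) (lebesgueWalk μ) (lebesgueWalk μ) := by
  have h := (measurePreserving_shiftSteps μ k).skew_product
    (g := fun (ξ : ℤ → ℝ) (y : ℝ) => y + twoSidedSum ξ k) (μc := volume) (μd := volume)
    (by unfold Function.uncurry; fun_prop)
    (Eventually.of_forall fun ξ => map_add_right_eq_self volume _)
  exact (Measure.measurePreserving_swap.comp h).comp Measure.measurePreserving_swap

theorem measurePreserving_translate (x : ℝ) :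
    MeasurePreserving (Prod.map (· - x) id) (lebesgueWalk μ) (lebesgueWalk μ) :=
  (measurePreserving_sub_right volume x).prod (.id _)

variable {μ}

theorem tendsto_walkPath (hint : Integrable id μ) (hpos : 0 < ∫ x, x ∂μ) :
    ∀ᵐ w ∂lebesgueWalk μ, Tendsto (walkPath w) atTop (𝓝 ⊤) ∧ Tendsto (walkPath w) atBot (𝓝 ⊥) := by
  filter_upwards [Measure.quasiMeasurePreserving_snd.ae (tendsto_twoSidedSum hint hpos)] with w hw
  exact ⟨EReal.tendsto_coe_nhds_top_iff.2 (tendsto_atTop_add_const_left _ _ hw.1),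
    EReal.tendsto_coe_nhds_bot_iff.2 (tendsto_atBot_add_const_left _ _ hw.2)⟩

theorem exists_walkPath_mem_firstHit (hint : Integrable id μ) (hpos : 0 < ∫ x, x ∂μ) (x : ℝ) :
    ∀ᵐ w ∂lebesgueWalk μ, ∃ k, walkPath w ∈ firstHit x k := by
  filter_upwards [tendsto_walkPath hint hpos] with w hw
  obtain ⟨b, hb⟩ := eventually_atBot.1 (hw.2.eventually_lt_const (EReal.bot_lt_coe x))
  exact exists_mem_firstHit (hw.1.eventually_const_lt (EReal.coe_lt_top x)).exists
    ⟨b, fun n hn => not_lt.1 fun h => (hb n h.le).not_gt hn⟩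

theorem lebesgueWalk_crossesAtZero_spatialShift (hint : Integrable id μ) (hpos : 0 < ∫ x, x ∂μ)
    (x : ℝ) {A : Set (ℤ → EReal)} (hA : MeasurableSet A) :
    lebesgueWalk μ (crossesAtZero 0 ∩ (fun w => spatialShift x (walkPath w)) ⁻¹' A) =
      lebesgueWalk μ (crossesAtZero 0 ∩ walkPath ⁻¹' A) := by
  have hC : ∀ x k, MeasurableSet (walkPath ⁻¹' firstHit x k) := fun x k =>
    measurable_walkPath (measurableSet_firstHit x k)
  have hd : ∀ x, Pairwise (Function.onFun Disjoint fun k => walkPath ⁻¹' firstHit x k) :=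
    fun x _ _ hkl => (pairwise_disjoint_firstHit x hkl).preimage _
  have hmap : Measurable (Prod.map (· - x) id : ℝ × (ℤ → ℝ) → ℝ × (ℤ → ℝ)) :=
    (measurePreserving_translate μ x).measurable
  have hS : MeasurableSet ((fun w => spatialShift x (walkPath w)) ⁻¹' A) :=
    ((measurable_spatialShift x).comp measurable_walkPath) hA
  let B : Set (ℝ × (ℤ → ℝ)) := crossesAtZero x ∩ (Prod.map (· - x) id) ⁻¹' (walkPath ⁻¹' A)
  have hB : MeasurableSet B := (measurableSet_crossesAtZero x).inter (hmap (measurable_walkPath hA))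
  have hB' : B = Prod.map (· - x) id ⁻¹' (crossesAtZero 0 ∩ walkPath ⁻¹' A) := by
    ext w
    simp only [B, crossesAtZero, Set.mem_inter_iff, Set.mem_preimage, Set.mem_ofPred_eq, Prod.map,
      id, sub_pos, sub_add_eq_add_sub, sub_nonpos]
  rw [← (measurePreserving_translate μ x).measure_preimage
      ((measurableSet_crossesAtZero 0).inter (measurable_walkPath hA)).nullMeasurableSet, ← hB',
    measure_eq_tsum_inter (hC x) (hd x) (exists_walkPath_mem_firstHit hint hpos x)
      ((measurableSet_crossesAtZero 0).inter hS),
    measure_eq_tsum_inter (hC 0) (hd 0) (exists_walkPath_mem_firstHit hint hpos 0) hB,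
    ← (Equiv.neg ℤ).tsum_eq]
  refine tsum_congr fun k => ?_
  rw [← (measurePreserving_timeShift μ k).measure_preimage
    (((measurableSet_crossesAtZero 0).inter hS).inter (hC _ _)).nullMeasurableSet]
  congr 1
  ext w
  have h1 : timeShift (-k) (timeShift k w) = w := by
    simpa using timeShift_neg_timeShift (-k) w
  have h2 := timeShift_mem_crossesAtZero (x := x) (k := -k) (w := timeShift k w)
  rw [h1] at h2
  simp only [Equiv.neg_apply, Set.mem_inter_iff, Set.mem_preimage, ← h2, B,
    ← timeShift_mem_crossesAtZero (x := 0) (k := k)]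
  constructor
  · rintro ⟨⟨h3, h4⟩, h5⟩
    rw [spatialShift_walkPath (h2.1 h5), h1] at h4
    exact ⟨⟨h5, h4⟩, h3⟩
  · rintro ⟨⟨h5, h4⟩, h3⟩
    refine ⟨⟨h3, ?_⟩, h5⟩
    rwa [spatialShift_walkPath (h2.1 h5), h1]

variable (μ)

/-- The two-sided walk started from Lebesgue measure, conditioned to become positive for the first
time at time `0`. -/
def stationaryWalk : Measure (ℤ → EReal) :=
  (ProbabilityTheory.cond (lebesgueWalk μ) (crossesAtZero 0)).map walkPath

variable {μ}

theorem map_spatialShift_stationaryWalk (hint : Integrable id μ) (hpos : 0 < ∫ x, x ∂μ) (x : ℝ) :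
    (stationaryWalk μ).map (spatialShift x) = stationaryWalk μ := by
  ext A hA
  rw [Measure.map_apply (by fun_prop) hA, stationaryWalk,
    Measure.map_apply (by fun_prop) (measurable_spatialShift x hA),
    Measure.map_apply (by fun_prop) hA, cond_apply (measurableSet_crossesAtZero 0),
    cond_apply (measurableSet_crossesAtZero 0)]
  congr 1
  exact lebesgueWalk_crossesAtZero_spatialShift hint hpos x hA

theorem ae_stationaryWalk {p : (ℤ → EReal) → Prop} (hp : MeasurableSet {ω | p ω})
    (h : ∀ᵐ w ∂lebesgueWalk μ, p (walkPath w)) : ∀ᵐ ω ∂stationaryWalk μ, p ω := by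
  rw [stationaryWalk, ae_map_iff (by fun_prop) hp]
  exact cond_absolutelyContinuous.ae_le h

end Laws

/-! ### A spatially stationary law is determined by its restriction to nonnegative times -/

theorem measurable_plusPart : Measurable plusPart := by
  unfold plusPart
  refine measurable_pi_lambda _ fun n => ?_
  split_ifs <;> fun_prop

theorem spatialShift_plusPart_apply {x : ℝ} {k m n : ℤ} {ω : ℤ → EReal} (h : ω ∈ firstHit x k)
    (hk : 0 ≤ k) (hn : -n ≤ k) (hmn : n = m) :
    spatialShift x (plusPart ω) m = spatialShift x ω m := by
  subst hmn
  have h' : plusPart ω ∈ firstHit x k := by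
    refine ⟨by simpa [plusPart, hk.not_gt] using h.1, fun j hj => ?_⟩
    simp only [plusPart]
    split_ifs
    · exact bot_le
    · exact h.2 j hj
  rw [spatialShift, spatialShift, hitTime_eq_of_mem_firstHit h, hitTime_eq_of_mem_firstHit h',
    plusPart, if_neg (by omega)]

/-- The hitting times of a proper sequence tend to infinity with the level. -/
theorem eventually_le_hitTime {ω : ℤ → EReal} (htop : ∀ n, ω n < ⊤)
    (hbot : Tendsto ω atBot (𝓝 ⊥)) (hlim : limsup ω atTop = ⊤) (N : ℤ) :
    ∀ᶠ x : ℕ in atTop, ∃ k, N ≤ k ∧ ω ∈ firstHit x k := by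
  obtain ⟨b, hb⟩ := eventually_atBot.1 (hbot.eventually_lt_const (EReal.bot_lt_coe 0))
  obtain ⟨M, hM⟩ : ∃ M : ℕ, ∀ n ∈ Finset.Icc b N, ω n ≤ ((M : ℝ) : EReal) := by
    have : ∀ n ∈ Finset.Icc b N, ∀ᶠ M : ℕ in atTop, ω n ≤ ((M : ℝ) : EReal) := fun n _ => by
      obtain ⟨r, hr⟩ := EReal.lt_iff_exists_real_btwn.1 (htop n)
      filter_upwards [tendsto_natCast_atTop_atTop.eventually_ge_atTop r] with M hM
      exact hr.1.le.trans (EReal.coe_le_coe_iff.2 hM)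
    exact ((Finset.eventually_all _).2 this).exists
  filter_upwards [eventually_ge_atTop M] with x hx
  have hle : ∀ n ≤ N, ω n ≤ ((x : ℝ) : EReal) := fun n hn => by
    rcases le_total n b with h | h
    · exact (hb n h).le.trans (EReal.coe_le_coe_iff.2 x.cast_nonneg)
    · exact (hM n (Finset.mem_Icc.2 ⟨h, hn⟩)).trans
        (EReal.coe_le_coe_iff.2 (Nat.cast_le.2 hx))
  have hlt : ∀ n, ((x : ℝ) : EReal) < ω n → N ≤ n := fun n hn =>
    not_lt.1 fun h => (hle n h.le).not_gt hn
  have hne : ∃ n, ((x : ℝ) : EReal) < ω n :=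
    (frequently_lt_of_lt_limsup (by isBoundedDefault)
      (hlim ▸ EReal.coe_lt_top (x : ℝ))).exists
  obtain ⟨k, hk⟩ := exists_mem_firstHit hne ⟨N, hlt⟩
  exact ⟨k, hlt k hk.1, hk⟩

theorem tendsto_spatialShift_plusPart {P : Measure (ℤ → EReal)} [IsProbabilityMeasure P]
    (htop : ∀ᵐ ω ∂P, ∀ n, ω n < ⊤) (hbot : ∀ᵐ ω ∂P, Tendsto ω atBot (𝓝 ⊥))
    (hlim : ∀ᵐ ω ∂P, limsup ω atTop = ⊤) (hstat : ∀ x : ℝ, P.map (spatialShift x) = P)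
    (s : Finset ℤ) {A : Set (s → EReal)} (hA : MeasurableSet A) :
    Tendsto (fun x : ℕ => (P.map plusPart).real (spatialShift x ⁻¹' (s.restrict ⁻¹' A))) atTop
      (𝓝 (P.real (s.restrict ⁻¹' A))) := by
  have hA' : MeasurableSet (s.restrict ⁻¹' A : Set (ℤ → EReal)) :=
    (Finset.measurable_restrict s) hA
  have hS : ∀ x : ℕ, MeasurableSet (spatialShift x ⁻¹' (s.restrict ⁻¹' A)) := fun x =>
    measurable_spatialShift x hA'
  have hS' : ∀ x : ℕ, MeasurableSet (plusPart ⁻¹' (spatialShift x ⁻¹' (s.restrict ⁻¹' A))) :=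
    fun x => measurable_plusPart (hS x)
  let f : ℕ → (ℤ → EReal) → ℝ := fun x ω =>
    (plusPart ⁻¹' (spatialShift x ⁻¹' (s.restrict ⁻¹' A))).indicator 1 ω -
      (spatialShift x ⁻¹' (s.restrict ⁻¹' A)).indicator 1 ω
  have hf : ∀ x, ∫ ω, f x ω ∂P = (P.map plusPart).real (spatialShift x ⁻¹' (s.restrict ⁻¹' A)) -
      P.real (s.restrict ⁻¹' A) := fun x => by
    have h1 : ∀ B : Set (ℤ → EReal), MeasurableSet B → Integrable (B.indicator (1 : (ℤ → EReal) → ℝ)) P :=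
      fun B hB => (integrable_const (1 : ℝ)).indicator hB
    rw [show ∫ ω, f x ω ∂P = _ from integral_sub (h1 _ (hS' x)) (h1 _ (hS x)),
      integral_indicator_one (hS' x), integral_indicator_one (hS x), map_measureReal_apply measurable_plusPart (hS x)]
    congr 1
    conv_rhs => rw [← hstat x]
    rw [map_measureReal_apply (by fun_prop) hA']
  have hlim0 : Tendsto (fun x => ∫ ω, f x ω ∂P) atTop (𝓝 (∫ _, (0 : ℝ) ∂P)) := by
    refine tendsto_integral_of_dominated_convergence (fun _ => 2) (fun x => ?_)
      (integrable_const _) (fun x => Eventually.of_forall fun ω => ?_) ?_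
    · exact ((measurable_one.indicator (hS' x)).sub
        (measurable_one.indicator (hS x))).aestronglyMeasurable
    · refine (norm_sub_le _ _).trans ?_
      have h : ∀ B : Set (ℤ → EReal), ‖B.indicator (1 : (ℤ → EReal) → ℝ) ω‖ ≤ 1 := fun B =>
        (norm_indicator_le_norm_self _ _).trans (by simp)
      linarith [h (plusPart ⁻¹' (spatialShift x ⁻¹' (s.restrict ⁻¹' A))),
        h (spatialShift x ⁻¹' (s.restrict ⁻¹' A))]
    · filter_upwards [htop, hbot, hlim] with ω h1 h2 h3
      obtain ⟨N, hN⟩ : ∃ N : ℤ, ∀ n ∈ s, -n ≤ N := by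
        obtain ⟨N, hN⟩ := (s.image Neg.neg).bddAbove
        exact ⟨N, fun n hn => hN (by simpa using hn)⟩
      refine tendsto_const_nhds.congr' ?_
      filter_upwards [eventually_le_hitTime h1 h2 h3 (max 0 N)] with x hx
      obtain ⟨k, hk, hkx⟩ := hx
      have : s.restrict (spatialShift x (plusPart ω)) = s.restrict (spatialShift x ω) := by
        ext n
        exact spatialShift_plusPart_apply hkx ((le_max_left _ _).trans hk)
          ((hN n n.2).trans ((le_max_right _ _).trans hk)) rfl
      simp only [f]
      rw [eq_comm, sub_eq_zero]
      have hiff : ω ∈ plusPart ⁻¹' (spatialShift x ⁻¹' (s.restrict ⁻¹' A)) ↔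
          ω ∈ spatialShift x ⁻¹' (s.restrict ⁻¹' A) := by
        change s.restrict (spatialShift x (plusPart ω)) ∈ A ↔ s.restrict (spatialShift x ω) ∈ A
        rw [this]
      classical
      simp only [Set.indicator_apply, hiff]
  simp only [hf, integral_zero] at hlim0
  simpa using hlim0.add_const (P.real (s.restrict ⁻¹' A))

theorem IsSpatiallyStationaryWalk.unique {c : ℝ} {P Q : Measure (ℤ → EReal)}
    [IsProbabilityMeasure P] [IsProbabilityMeasure Q] (hP : IsSpatiallyStationaryWalk c P)
    (hQ : IsSpatiallyStationaryWalk c Q) : P = Q := by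
  refine IsProjectiveLimit.unique (P := fun s : Finset ℤ => P.map s.restrict) (fun _ => rfl)
    fun s => ?_
  ext A hA
  have h1 := tendsto_spatialShift_plusPart hP.lt_top hP.tendsto_bot hP.limsup_top hP.stationary s hA
  have h2 := tendsto_spatialShift_plusPart hQ.lt_top hQ.tendsto_bot hQ.limsup_top hQ.stationary s hA
  rw [hP.plus, ← hQ.plus] at h1
  have h := tendsto_nhds_unique h2 h1
  rw [Measure.map_apply (Finset.measurable_restrict s) hA,
    Measure.map_apply (Finset.measurable_restrict s) hA]
  exact (measureReal_eq_measureReal_iff (by finiteness) (by finiteness)).1 h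

/-! ### The first ladder jump and the stationary overshoot -/

theorem measurable_add_partialSum (y : ℝ) :
    Measurable fun (a : ℕ → ℝ) (n : ℕ) => y + partialSum a n :=
  measurable_pi_lambda _ fun n => by fun_prop

theorem walkLaw_dirac (c y : ℝ) : walkLaw c (Measure.dirac y) =
    (iidLaw ℕ (stepLaw c)).map fun a n => y + partialSum a n := by
  rw [walkLaw, Measure.dirac_prod, Measure.map_map (by fun_prop) (by fun_prop)]
  rfl

instance (c y : ℝ) : IsProbabilityMeasure (walkLaw c (Measure.dirac y)) := by
  rw [walkLaw_dirac]
  exact Measure.isProbabilityMeasure_map (by fun_prop)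

theorem lt_firstLadderJump_iff (x : ℝ) {y : ℝ} (hy : 0 ≤ y) (a : ℕ → ℝ) :
    y < firstLadderJump (fun n => x + partialSum a n) ↔ a ∈ ladderAbove y := by
  have hset : {n | 0 < n ∧ x < x + partialSum a n} = {n | 0 < n ∧ 0 < partialSum a n} := by simp
  simp only [firstLadderJump, partialSum_zero, add_zero, hset, add_sub_cancel_left, ladderAbove,
    Set.mem_iUnion, ladderAt, Set.mem_ofPred_eq]
  constructor
  · intro h
    have hne : {n | 0 < n ∧ 0 < partialSum a n}.Nonempty := by
      by_contra! h0
      rw [h0, Nat.sInf_empty, partialSum_zero] at h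
      exact hy.not_gt h
    have hmem := Nat.sInf_mem hne
    refine ⟨sInf {n | 0 < n ∧ 0 < partialSum a n} - 1, ?_⟩
    rw [Nat.sub_add_cancel hmem.1]
    exact ⟨fun j hj hjn => not_lt.1 fun hlt => Nat.notMem_of_lt_sInf hjn ⟨hj, hlt⟩, h⟩
  · rintro ⟨n, hn, hyn⟩
    have : IsLeast {n | 0 < n ∧ 0 < partialSum a n} (n + 1) :=
      ⟨⟨n.succ_pos, hy.trans_lt hyn⟩, fun j hj => not_lt.1 fun hlt =>
        (hn j hj.1 hlt).not_gt hj.2⟩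
    rwa [this.csInf_eq]

theorem firstLadderJump_nonneg (s : ℕ → ℝ) : 0 ≤ firstLadderJump s := by
  rcases Set.eq_empty_or_nonempty {n | 0 < n ∧ s 0 < s n} with h | h
  · simp [firstLadderJump, h]
  · exact sub_nonneg.2 (Nat.sInf_mem h).2.le

theorem measurable_firstLadderJump : Measurable firstLadderJump := by
  refine measurable_of_Ioi fun y => ?_
  rcases lt_or_ge y 0 with hy | hy
  · convert MeasurableSet.univ
    exact Set.eq_univ_of_forall fun s => hy.trans_le (firstLadderJump_nonneg s)
  · have h : Measurable fun (s : ℕ → ℝ) (n : ℕ) => s (n + 1) - s n := by fun_prop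
    convert h (measurableSet_ladderAbove y) using 1
    ext s
    rw [Set.mem_preimage, Set.mem_preimage, ← lt_firstLadderJump_iff (s 0) hy]
    simp only [partialSum, Finset.sum_range_sub, add_sub_cancel, Set.mem_Ioi]

theorem measurableSet_lt_firstLadderJump (y : ℝ) : MeasurableSet {s | y < firstLadderJump s} :=
  measurable_firstLadderJump measurableSet_Ioi

theorem walkLaw_lt_firstLadderJump (c x : ℝ) {y : ℝ} (hy : 0 ≤ y) :
    walkLaw c (Measure.dirac x) {s | y < firstLadderJump s} =
      iidLaw ℕ (stepLaw c) (ladderAbove y) := by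
  rw [walkLaw_dirac, Measure.map_apply (by fun_prop) (measurableSet_lt_firstLadderJump y)]
  congr 1
  ext a
  exact lt_firstLadderJump_iff x hy a

theorem ladderMean_eq (c : ℝ) :
    ladderMean c = ∫⁻ y in Set.Ici 0, iidLaw ℕ (stepLaw c) (ladderAbove y) := by
  rw [ladderMean, lintegral_eq_lintegral_meas_lt _
    (Eventually.of_forall firstLadderJump_nonneg) measurable_firstLadderJump.aemeasurable,
    restrict_Ioi_eq_restrict_Ici]
  exact setLIntegral_congr_fun measurableSet_Ici fun y hy => walkLaw_lt_firstLadderJump c 0 hy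

theorem measurableSet_staysPositive : MeasurableSet staysPositive := by
  unfold staysPositive
  simp only [Set.ofPred_forall]
  exact .iInter fun n => .iInter fun _ => measurableSet_lt measurable_const (by fun_prop)

theorem preimage_staysPositive (x : ℝ) :
    (fun (a : ℕ → ℝ) (n : ℕ) => -x + partialSum a n) ⁻¹' staysPositive = staysAbove x := by
  ext a
  simp [staysPositive, staysAbove]

theorem walkLaw_staysPositive (c x : ℝ) :
    walkLaw c (Measure.dirac (-x)) staysPositive = iidLaw ℕ (stepLaw c) (staysAbove x) := by
  rw [walkLaw_dirac, Measure.map_apply (by fun_prop) measurableSet_staysPositive,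
    preimage_staysPositive]

theorem walkCondPositive_eq (c x : ℝ) : walkCondPositive c (-x) =
    (ProbabilityTheory.cond (iidLaw ℕ (stepLaw c)) (staysAbove x)).map
      fun a n => -x + partialSum a n := by
  rw [walkCondPositive, ProbabilityTheory.cond, walkLaw_staysPositive, ProbabilityTheory.cond,
    Measure.map_smul, walkLaw_dirac, Measure.restrict_map (by fun_prop) measurableSet_staysPositive,
    preimage_staysPositive]

theorem measurable_iidLaw_ladderAbove_tail (c : ℝ) : Measurable fun y : ℝ =>
    walkLaw c (Measure.dirac 0) {s | y < firstLadderJump s} :=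
  Antitone.measurable fun _ _ h => measure_mono fun _ hs => h.trans_lt hs

theorem iidLaw_ladderAbove_pos {c : ℝ} (htail : ∀ y, 0 < stepLaw c (Set.Ioi y)) (y : ℝ) :
    0 < iidLaw ℕ (stepLaw c) (ladderAbove y) := by
  refine (htail y).trans_le ?_
  rw [← (measurePreserving_eval_infinitePi (fun _ : ℕ => stepLaw c) 0).measure_preimage
    measurableSet_Ioi.nullMeasurableSet]
  refine measure_mono fun a ha => Set.mem_iUnion.2 ⟨0, fun j _ _ => by omega, ?_⟩
  simpa [partialSum] using ha

theorem iidLaw_staysAbove_pos {c : ℝ} (hint : Integrable id (stepLaw c))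
    (hpos : 0 < ∫ x, x ∂stepLaw c) (htail : ∀ y, 0 < stepLaw c (Set.Ioi y)) {y : ℝ} (hy : 0 ≤ y) :
    0 < iidLaw ℕ (stepLaw c) (staysAbove y) := by
  rw [iidLaw_staysAbove hint hpos hy]
  exact ENNReal.mul_pos (iidLaw_staysAbove_zero_pos hint hpos).ne'
    (iidLaw_ladderAbove_pos htail y).ne'

theorem lintegral_iidLaw_staysAbove_lt_top {c : ℝ} (hint : Integrable id (stepLaw c)) :
    ∫⁻ y in Set.Ici 0, iidLaw ℕ (stepLaw c) (staysAbove y) < ⊤ := by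
  have hm := measurePreserving_eval_infinitePi (fun _ : ℕ => stepLaw c) 0
  have h1 : Integrable (fun a : ℕ → ℝ => |a 0|) (iidLaw ℕ (stepLaw c)) :=
    (hm.integrable_comp_of_integrable hint).abs
  have h2 := h1.lintegral_lt_top
  rw [lintegral_eq_lintegral_meas_lt _ (Eventually.of_forall fun a => abs_nonneg _)
    h1.aemeasurable, restrict_Ioi_eq_restrict_Ici] at h2
  refine (lintegral_mono fun y => measure_mono fun a ha => ?_).trans_lt h2
  have := ha 1 le_rfl
  simp only [partialSum, Finset.sum_range_one] at this
  exact this.trans_le (le_abs_self _)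

theorem lintegral_iidLaw_staysAbove {c : ℝ} (hint : Integrable id (stepLaw c))
    (hpos : 0 < ∫ x, x ∂stepLaw c) :
    ∫⁻ y in Set.Ici 0, iidLaw ℕ (stepLaw c) (staysAbove y) =
      iidLaw ℕ (stepLaw c) (staysAbove 0) * ladderMean c := by
  rw [ladderMean_eq, ← lintegral_const_mul' _ _ (measure_ne_top _ _)]
  exact setLIntegral_congr_fun measurableSet_Ici fun y hy => iidLaw_staysAbove hint hpos hy

theorem ladderMean_ne_top {c : ℝ} (hint : Integrable id (stepLaw c))
    (hpos : 0 < ∫ x, x ∂stepLaw c) : ladderMean c ≠ ⊤ := fun h => by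
  have h1 := lintegral_iidLaw_staysAbove_lt_top hint
  rw [lintegral_iidLaw_staysAbove hint hpos, h,
    ENNReal.mul_top (iidLaw_staysAbove_zero_pos hint hpos).ne'] at h1
  exact lt_irrefl _ h1

theorem ladderMean_ne_zero {c : ℝ} (htail : ∀ y, 0 < stepLaw c (Set.Ioi y)) :
    ladderMean c ≠ 0 := fun h => by
  rw [ladderMean, lintegral_eq_zero_iff measurable_firstLadderJump.ennreal_ofReal] at h
  have h1 := walkLaw_lt_firstLadderJump c 0 le_rfl
  rw [measure_mono_null (fun s hs => ?_) (ae_iff.1 h)] at h1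
  · exact (iidLaw_ladderAbove_pos htail 0).ne h1
  · simpa using hs

/-! ### The stationary walk seen from time zero -/

/-- The starting position, the future increments and the past increments. -/
def futurePast (w : ℝ × (ℤ → ℝ)) : ℝ × (ℕ → ℝ) × (ℕ → ℝ) := (w.1, futureSteps w.2, pastSteps w.2)

@[fun_prop] theorem measurable_futurePast : Measurable futurePast := by
  unfold futurePast; fun_prop

theorem measurePreserving_futurePast (μ : Measure ℝ) [IsProbabilityMeasure μ] :
    MeasurePreserving futurePast (lebesgueWalk μ)
      ((volume : Measure ℝ).prod ((iidLaw ℕ μ).prod (iidLaw ℕ μ))) :=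
  (MeasurePreserving.id _).prod (measurePreserving_future_past μ)

theorem ae_volume_prod_ne {β : Type*} [MeasurableSpace β] {ν : Measure β} [SFinite ν] {g : β → ℝ}
    (hg : Measurable g) : ∀ᵐ p ∂(volume : Measure ℝ).prod ν, p.1 ≠ g p.2 := by
  have hs : MeasurableSet {p : ℝ × β | p.1 = g p.2} :=
    measurableSet_eq_fun measurable_fst (hg.comp measurable_snd)
  rw [ae_iff]
  simp only [not_not]
  rw [Measure.prod_apply_symm hs]
  refine (lintegral_congr fun z => ?_).trans lintegral_zero
  have : (fun y => (y, z)) ⁻¹' {p : ℝ × β | p.1 = g p.2} = {g z} := by ext; simp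
  rw [this, Real.volume_singleton]

theorem crossesAtZero_ae_eq (μ : Measure ℝ) [IsProbabilityMeasure μ] :
    crossesAtZero 0 =ᵐ[lebesgueWalk μ]
      futurePast ⁻¹' {q | 0 ≤ q.1 ∧ q.2.2 ∈ staysAbove q.1} := by
  have h0 : ∀ᵐ q ∂(volume : Measure ℝ).prod ((iidLaw ℕ μ).prod (iidLaw ℕ μ)),
      ∀ n, q.1 ≠ partialSum q.2.2 n :=
    ae_all_iff.2 fun n => ae_volume_prod_ne ((measurable_partialSum n).comp measurable_snd)
  filter_upwards [(measurePreserving_futurePast μ).quasiMeasurePreserving.ae h0] with w hw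
  rw [eq_iff_iff]
  change (0 < w.1 ∧ ∀ n : ℤ, n < 0 → w.1 + twoSidedSum w.2 n ≤ 0) ↔
    (0 ≤ w.1 ∧ ∀ n, 1 ≤ n → w.1 < partialSum (pastSteps w.2) n)
  have hw0 : w.1 ≠ 0 := by simpa [futurePast] using hw 0
  refine and_congr ⟨le_of_lt, fun h => h.lt_of_ne' hw0⟩ ⟨fun h n hn => ?_, fun h n hn => ?_⟩
  · have := h (-n) (by omega)
    rw [twoSidedSum_neg_natCast, ← sub_eq_add_neg, sub_nonpos] at this
    exact this.lt_of_ne (hw n)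
  · have := h n.natAbs (by omega)
    obtain ⟨m, hm⟩ : ∃ m : ℕ, n = -m := ⟨n.natAbs, by omega⟩
    rw [hm, Int.natAbs_neg, Int.natAbs_natCast] at this
    rw [hm, twoSidedSum_neg_natCast]
    linarith

theorem measurableSet_staysAbove_graph :
    MeasurableSet {q : ℝ × (ℕ → ℝ) × (ℕ → ℝ) | 0 ≤ q.1 ∧ q.2.2 ∈ staysAbove q.1} := by
  simp only [staysAbove, Set.mem_ofPred_eq]
  simp only [Set.ofPred_and, Set.ofPred_forall]
  exact .inter (measurableSet_le measurable_const (by fun_prop)) (.iInter fun n => .iInter fun _ =>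
    measurableSet_lt (by fun_prop) (by fun_prop))

theorem lebesgueWalk_crossesAtZero_inter (μ : Measure ℝ) [IsProbabilityMeasure μ]
    {D : Set (ℝ × (ℕ → ℝ) × (ℕ → ℝ))} (hD : MeasurableSet D) :
    lebesgueWalk μ (crossesAtZero 0 ∩ futurePast ⁻¹' D) =
      ∫⁻ y in Set.Ici 0,
        (iidLaw ℕ μ).prod ((iidLaw ℕ μ).restrict (staysAbove y)) (Prod.mk y ⁻¹' D) := by
  have h := measure_congr ((crossesAtZero_ae_eq μ).inter (ae_eq_refl (futurePast ⁻¹' D)))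
  rw [h, ← Set.preimage_inter,
    (measurePreserving_futurePast μ).measure_preimage
      (measurableSet_staysAbove_graph.inter hD).nullMeasurableSet,
    Measure.prod_apply (measurableSet_staysAbove_graph.inter hD),
    ← lintegral_indicator measurableSet_Ici]
  refine lintegral_congr fun y => ?_
  by_cases hy : 0 ≤ y
  · rw [Set.indicator_of_mem (Set.mem_Ici.2 hy)]
    conv_rhs => rw [← Measure.restrict_univ (μ := iidLaw ℕ μ), Measure.prod_restrict,
      Measure.restrict_apply (measurable_prodMk_left hD)]
    rw [Measure.restrict_univ]
    congr 1
    ext p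
    simp [hy, and_comm]
  · rw [Set.indicator_of_notMem (by simpa using hy)]
    have : Prod.mk y ⁻¹' ({q : ℝ × (ℕ → ℝ) × (ℕ → ℝ) | 0 ≤ q.1 ∧ q.2.2 ∈ staysAbove q.1} ∩ D) = ∅ := by
      ext p; simp [hy]
    rw [this, measure_empty]

theorem lebesgueWalk_crossesAtZero {c : ℝ} (hint : Integrable id (stepLaw c))
    (hpos : 0 < ∫ x, x ∂stepLaw c) : lebesgueWalk (stepLaw c) (crossesAtZero 0) =
      iidLaw ℕ (stepLaw c) (staysAbove 0) * ladderMean c := by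
  have h := lebesgueWalk_crossesAtZero_inter (stepLaw c) MeasurableSet.univ
  simp only [Set.preimage_univ, Set.inter_univ] at h
  rw [h, ← lintegral_iidLaw_staysAbove hint hpos]
  refine lintegral_congr fun y => ?_
  rw [← Set.univ_prod_univ, Measure.prod_prod, measure_univ, one_mul, Measure.restrict_apply_univ]

/-- Under the stationary walk, the position at time zero is an overshoot, and conditionally on it
the future is free and the past is conditioned to stay below zero. -/
theorem map_futurePast_apply {c : ℝ} (hint : Integrable id (stepLaw c))
    (hpos : 0 < ∫ x, x ∂stepLaw c) (htail : ∀ y, 0 < stepLaw c (Set.Ioi y))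
    {D : Set (ℝ × (ℕ → ℝ) × (ℕ → ℝ))} (hD : MeasurableSet D) :
    (ProbabilityTheory.cond (lebesgueWalk (stepLaw c)) (crossesAtZero 0)).map futurePast D =
      ∫⁻ y, (iidLaw ℕ (stepLaw c)).prod
        (ProbabilityTheory.cond (iidLaw ℕ (stepLaw c)) (staysAbove y)) (Prod.mk y ⁻¹' D)
        ∂overshootLaw c := by
  have hp0 := (iidLaw_staysAbove_zero_pos hint hpos).ne'
  have hpt := measure_ne_top (iidLaw ℕ (stepLaw c)) (staysAbove 0)
  have hL0 := ladderMean_ne_zero htail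
  have hLt := ladderMean_ne_top hint hpos
  rw [Measure.map_apply (by fun_prop) hD, cond_apply (measurableSet_crossesAtZero 0),
    lebesgueWalk_crossesAtZero_inter _ hD, lebesgueWalk_crossesAtZero hint hpos, overshootLaw,
    lintegral_withDensity_eq_lintegral_mul_non_measurable _
      ((measurable_iidLaw_ladderAbove_tail c).const_mul _)
      (Eventually.of_forall fun y => ENNReal.mul_lt_top (ENNReal.inv_lt_top.2
        (pos_iff_ne_zero.2 hL0)) (measure_lt_top _ _)),
    ← lintegral_const_mul' _ _ (ENNReal.inv_ne_top.2 (mul_ne_zero hp0 hL0))]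
  refine setLIntegral_congr_fun measurableSet_Ici fun y hy => ?_
  have hq0 := (iidLaw_ladderAbove_pos htail y).ne'
  have hqt := measure_ne_top (iidLaw ℕ (stepLaw c)) (ladderAbove y)
  simp only [Pi.mul_apply]
  rw [walkLaw_lt_firstLadderJump c 0 hy, ProbabilityTheory.cond, Measure.prod_smul_right,
    Measure.smul_apply, smul_eq_mul, iidLaw_staysAbove hint hpos hy, ← mul_assoc]
  congr 1
  rw [ENNReal.mul_inv (.inl hp0) (.inl hpt), ENNReal.mul_inv (.inl hp0) (.inl hpt),
    mul_comm _ (_⁻¹ * _⁻¹), mul_mul_mul_comm, mul_assoc _ _ (_ * _), mul_left_comm _⁻¹ _⁻¹ _,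
    ENNReal.inv_mul_cancel hq0 hqt, mul_one, mul_comm]

/-! ### Exponential moments and mean of the step distribution -/

theorem stepDensity_pos (c u : ℝ) : 0 < stepDensity c u := by
  unfold stepDensity; positivity

theorem measurable_stepDensity (c : ℝ) : Measurable (stepDensity c) := by
  unfold stepDensity; fun_prop

theorem exp_mul_stepDensity_eq (c u : ℝ) {s : ℝ} (h1 : -(5 / 2) < s) (h2 : s < 1 / 2) :
    ENNReal.ofReal (Real.exp (s * u) * stepDensity c u) =
      ENNReal.ofReal (Real.exp (s * Real.log c) / (2 * Real.sin (Real.pi * ((s + 5 / 2) / 3)))) *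
      (ENNReal.ofReal |Real.sigmoid (3 * (u - Real.log c)) *
          (1 - Real.sigmoid (3 * (u - Real.log c))) * 3| *
        betaPDF ((s + 5 / 2) / 3) (1 - (s + 5 / 2) / 3) (Real.sigmoid (3 * (u - Real.log c)))) := by
  have ha0 : 0 < (s + 5 / 2) / 3 := by linarith
  have ha1 : (s + 5 / 2) / 3 < 1 := by linarith
  have hsin : 0 < Real.sin (Real.pi * ((s + 5 / 2) / 3)) :=
    Real.sin_pos_of_pos_of_lt_pi (by positivity) (by nlinarith [Real.pi_pos])
  have hB : beta ((s + 5 / 2) / 3) (1 - (s + 5 / 2) / 3) =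
      Real.pi / Real.sin (Real.pi * ((s + 5 / 2) / 3)) := by
    rw [beta, add_sub_cancel, Real.Gamma_one, div_one, Real.Gamma_mul_Gamma_one_sub]
  have hσ0 := Real.sigmoid_pos (3 * (u - Real.log c))
  have hσ1 := Real.sigmoid_lt_one (3 * (u - Real.log c))
  have hσ : 1 - Real.sigmoid (3 * (u - Real.log c)) =
      (1 + Real.exp (3 * (u - Real.log c)))⁻¹ := by
    rw [Real.sigmoid_def, Real.exp_neg]; field_simp; ring
  have hσ' : Real.sigmoid (3 * (u - Real.log c)) = Real.exp (3 * (u - Real.log c)) *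
      (1 - Real.sigmoid (3 * (u - Real.log c))) := by
    rw [hσ, Real.sigmoid_def, Real.exp_neg]; field_simp; ring
  rw [betaPDF_of_pos_lt_one hσ0 hσ1, hB]
  have hτ : 0 < 1 - Real.sigmoid (3 * (u - Real.log c)) := by linarith
  have key : Real.sigmoid (3 * (u - Real.log c)) * (1 - Real.sigmoid (3 * (u - Real.log c))) *
      (Real.sigmoid (3 * (u - Real.log c)) ^ ((s + 5 / 2) / 3 - 1) *
      (1 - Real.sigmoid (3 * (u - Real.log c))) ^ (1 - (s + 5 / 2) / 3 - 1)) =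
      Real.exp ((s + 5 / 2) * (u - Real.log c)) / (1 + Real.exp (3 * (u - Real.log c))) := by
    rw [Real.rpow_sub_one hσ0.ne', Real.rpow_sub_one hτ.ne', Real.rpow_sub hτ, Real.rpow_one,
      show Real.sigmoid (3 * (u - Real.log c)) ^ ((s + 5 / 2) / 3) =
        Real.exp ((s + 5 / 2) * (u - Real.log c)) *
          (1 - Real.sigmoid (3 * (u - Real.log c))) ^ ((s + 5 / 2) / 3) by
        conv_lhs => rw [hσ']
        rw [Real.mul_rpow (Real.exp_pos _).le hτ.le, ← Real.exp_mul]
        congr 2; ring,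
      div_eq_mul_inv (Real.exp _) (1 + _), ← hσ]
    have := (Real.rpow_pos_of_pos hτ ((s + 5 / 2) / 3)).ne'
    field_simp
  rw [← ENNReal.ofReal_mul (abs_nonneg _), ← ENNReal.ofReal_mul (by positivity),
    abs_of_pos (by positivity), stepDensity]
  congr 1
  have hexp : Real.exp (s * u) * Real.exp (5 / 2 * (u - Real.log c)) =
      Real.exp (s * Real.log c) * Real.exp ((s + 5 / 2) * (u - Real.log c)) := by
    rw [← Real.exp_add, ← Real.exp_add]; congr 1; ring
  calc _ = 3 / (2 * Real.pi) * (Real.exp (s * u) * Real.exp (5 / 2 * (u - Real.log c)) /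
        (1 + Real.exp (3 * (u - Real.log c)))) := by ring
    _ = 3 / (2 * Real.pi) * Real.exp (s * Real.log c) *
        (Real.exp ((s + 5 / 2) * (u - Real.log c)) / (1 + Real.exp (3 * (u - Real.log c)))) := by
      rw [hexp]; ring
    _ = _ := by
      rw [← key]
      have h3 := Real.pi_pos.ne'
      generalize Real.sin (Real.pi * ((s + 5 / 2) / 3)) = S at hsin
      have h4 := hsin.ne'
      field_simp

theorem lintegral_exp_mul_stepLaw (c : ℝ) {s : ℝ} (h1 : -(5 / 2) < s) (h2 : s < 1 / 2) :
    ∫⁻ u, ENNReal.ofReal (Real.exp (s * u)) ∂stepLaw c =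
      ENNReal.ofReal
        (Real.exp (s * Real.log c) / (2 * Real.sin (Real.pi * ((s + 5 / 2) / 3)))) := by
  have hd : ∀ u ∈ Set.univ, HasDerivWithinAt (fun u => Real.sigmoid (3 * (u - Real.log c)))
      (Real.sigmoid (3 * (u - Real.log c)) * (1 - Real.sigmoid (3 * (u - Real.log c))) * 3)
      Set.univ u := fun u _ => by
    have h := (((hasDerivAt_id u).sub_const (Real.log c)).const_mul 3)
    rw [mul_one] at h
    exact ((Real.hasDerivAt_sigmoid _).comp u h).hasDerivWithinAt
  have hinj : Set.InjOn (fun u => Real.sigmoid (3 * (u - Real.log c))) Set.univ :=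
    fun u _ v _ huv => by
      have := Real.sigmoid_injective huv
      linarith
  have himage : (fun u => Real.sigmoid (3 * (u - Real.log c))) '' Set.univ = Set.Ioo 0 1 := by
    rw [← Real.range_sigmoid, Set.image_univ]
    refine Set.Subset.antisymm (Set.range_subset_iff.2 fun u => ⟨_, rfl⟩) ?_
    rintro _ ⟨t, rfl⟩
    exact ⟨t / 3 + Real.log c, by simp only; congr 1; ring⟩
  have hcv := lintegral_image_eq_lintegral_abs_deriv_mul MeasurableSet.univ hd hinj
    (betaPDF ((s + 5 / 2) / 3) (1 - (s + 5 / 2) / 3))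
  have hbeta : ∫⁻ x in Set.Ioo 0 1, betaPDF ((s + 5 / 2) / 3) (1 - (s + 5 / 2) / 3) x = 1 := by
    rw [← lintegral_betaPDF_eq_one (α := (s + 5 / 2) / 3) (β := 1 - (s + 5 / 2) / 3)
      (by linarith) (by linarith), lintegral_betaPDF]
    exact setLIntegral_congr_fun measurableSet_Ioo fun x hx => betaPDF_of_pos_lt_one hx.1 hx.2
  rw [himage, hbeta, Measure.restrict_univ] at hcv
  rw [stepLaw, lintegral_withDensity_eq_lintegral_mul _
    (measurable_stepDensity c).ennreal_ofReal (by fun_prop)]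
  rw [← mul_one (ENNReal.ofReal (_ / _)), hcv, ← lintegral_const_mul' _ _ ENNReal.ofReal_ne_top]
  refine lintegral_congr fun u => ?_
  rw [← exp_mul_stepDensity_eq c u h1 h2, Pi.mul_apply,
    ← ENNReal.ofReal_mul (stepDensity_pos c u).le, mul_comm]

theorem integrable_exp_mul_stepLaw (c : ℝ) {s : ℝ} (h1 : -(5 / 2) < s) (h2 : s < 1 / 2) :
    Integrable (fun u => Real.exp (s * u)) (stepLaw c) := by
  refine ⟨by fun_prop, ?_⟩
  rw [hasFiniteIntegral_iff_ofReal (Eventually.of_forall fun u => (Real.exp_pos _).le),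
    lintegral_exp_mul_stepLaw c h1 h2]
  exact ENNReal.ofReal_lt_top

theorem mgf_stepLaw (c : ℝ) {s : ℝ} (h1 : -(5 / 2) < s) (h2 : s < 1 / 2) :
    mgf id (stepLaw c) s =
      Real.exp (s * Real.log c) / (2 * Real.sin (Real.pi * ((s + 5 / 2) / 3))) := by
  have hsin : 0 < Real.sin (Real.pi * ((s + 5 / 2) / 3)) :=
    Real.sin_pos_of_pos_of_lt_pi (by have := Real.pi_pos; apply mul_pos this; linarith)
      (by nlinarith [Real.pi_pos])
  simp only [mgf, id]
  rw [integral_eq_lintegral_of_nonneg_ae (Eventually.of_forall fun u => (Real.exp_pos _).le)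
    (by fun_prop), lintegral_exp_mul_stepLaw c h1 h2, ENNReal.toReal_ofReal (by positivity)]

theorem zero_mem_interior_integrableExpSet (c : ℝ) :
    0 ∈ interior (integrableExpSet id (stepLaw c)) :=
  mem_interior.2 ⟨Set.Ioo (-(5 / 2)) (1 / 2),
    fun _ hs => integrable_exp_mul_stepLaw c hs.1 hs.2, isOpen_Ioo, by norm_num⟩

theorem integrable_id_stepLaw (c : ℝ) : Integrable id (stepLaw c) :=
  integrable_of_mem_interior_integrableExpSet (zero_mem_interior_integrableExpSet c)

theorem integral_stepLaw (c : ℝ) : ∫ x, x ∂stepLaw c = Real.log c + Real.pi / Real.sqrt 3 := by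
  have h1 := hasDerivAt_mgf (zero_mem_interior_integrableExpSet c)
  simp only [id, zero_mul, Real.exp_zero, mul_one] at h1
  have hs : Real.sin (Real.pi * ((0 + 5 / 2) / 3)) = 1 / 2 := by
    rw [show Real.pi * ((0 + 5 / 2) / 3) = Real.pi - Real.pi / 6 by ring, Real.sin_pi_sub,
      Real.sin_pi_div_six]
  have hcos : Real.cos (Real.pi * ((0 + 5 / 2) / 3)) = -(Real.sqrt 3 / 2) := by
    rw [show Real.pi * ((0 + 5 / 2) / 3) = Real.pi - Real.pi / 6 by ring, Real.cos_pi_sub,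
      Real.cos_pi_div_six]
  have h2 : HasDerivAt (fun s : ℝ =>
      Real.exp (s * Real.log c) / (2 * Real.sin (Real.pi * ((s + 5 / 2) / 3)))) _ 0 :=
    (((hasDerivAt_id (0 : ℝ)).mul_const (Real.log c)).exp).div
      ((((((hasDerivAt_id (0 : ℝ)).add_const (5 / 2)).div_const 3).const_mul Real.pi).sin).const_mul 2)
      (by rw [hs]; norm_num)
  have heq : mgf id (stepLaw c) =ᶠ[𝓝 0] fun s : ℝ =>
      Real.exp (s * Real.log c) / (2 * Real.sin (Real.pi * ((s + 5 / 2) / 3))) := by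
    filter_upwards [Ioo_mem_nhds (show (-(5 / 2) : ℝ) < 0 by norm_num)
      (show (0 : ℝ) < 1 / 2 by norm_num)] with s hs
    exact mgf_stepLaw c hs.1 hs.2
  rw [h1.unique (h2.congr_of_eventuallyEq heq)]
  simp only [id, hs, hcos, zero_mul, Real.exp_zero]
  have h3 : Real.sqrt 3 * Real.sqrt 3 = 3 := Real.mul_self_sqrt (by norm_num)
  have h4 : Real.sqrt 3 ≠ 0 := by positivity
  field_simp
  linear_combination Real.pi * h3

theorem integral_stepLaw_pos {c : ℝ} (hc : Real.exp (-(Real.pi / Real.sqrt 3)) < c) :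
    0 < ∫ x, x ∂stepLaw c := by
  rw [integral_stepLaw]
  have := (Real.lt_log_iff_exp_lt ((Real.exp_pos _).trans hc)).2 hc
  linarith

theorem stepLaw_Ioi_pos (c y : ℝ) : 0 < stepLaw c (Set.Ioi y) := by
  rw [stepLaw, withDensity_apply _ measurableSet_Ioi, setLIntegral_pos_iff
    (measurable_stepDensity c).ennreal_ofReal]
  have : (Function.support fun u => ENNReal.ofReal (stepDensity c u)) = Set.univ :=
    Set.eq_univ_of_forall fun u => (ENNReal.ofReal_pos.2 (stepDensity_pos c u)).ne'
  rw [this, Set.univ_inter, Real.volume_Ioi]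
  exact ENNReal.zero_lt_top

/-! ### The spatially stationary random walk -/

@[fun_prop] theorem measurable_extendBot : Measurable extendBot := by
  unfold extendBot
  refine measurable_pi_lambda _ fun n => ?_
  split_ifs
  · fun_prop
  · exact measurable_coe_real_ereal.comp (by fun_prop)

theorem measurable_coe_path : Measurable fun (s : ℕ → ℝ) (n : ℕ) => (s n : EReal) :=
  measurable_pi_lambda _ fun n => measurable_coe_real_ereal.comp (by fun_prop)

/-- The process that runs the path backwards from time zero, with the opposite sign. -/
def reversedPast (ω : ℤ → EReal) : ℕ → EReal := fun n => -ω (-(n : ℤ))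

theorem measurable_reversedPast : Measurable reversedPast := by
  unfold reversedPast
  exact measurable_pi_lambda _ fun n => by fun_prop

theorem ae_overshootLaw_nonneg (c : ℝ) : ∀ᵐ y ∂overshootLaw c, 0 ≤ y :=
  (withDensity_absolutelyContinuous _ _).ae_le (ae_restrict_mem measurableSet_Ici)

section Stationary

variable {c : ℝ}

theorem isProbabilityMeasure_stationaryWalk (hc : Real.exp (-(Real.pi / Real.sqrt 3)) < c) :
    IsProbabilityMeasure (stationaryWalk (stepLaw c)) := by
  have hint := integrable_id_stepLaw c
  have hpos := integral_stepLaw_pos hc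
  have hL := lebesgueWalk_crossesAtZero hint hpos
  have : IsProbabilityMeasure
      (ProbabilityTheory.cond (lebesgueWalk (stepLaw c)) (crossesAtZero 0)) := by
    refine cond_isProbabilityMeasure_of_finite ?_ ?_
    · rw [hL]
      exact mul_ne_zero (iidLaw_staysAbove_zero_pos hint hpos).ne'
        (ladderMean_ne_zero (stepLaw_Ioi_pos c))
    · rw [hL]
      exact ENNReal.mul_ne_top (measure_ne_top _ _) (ladderMean_ne_top hint hpos)
  exact Measure.isProbabilityMeasure_map (by fun_prop)

theorem map_start_future (hc : Real.exp (-(Real.pi / Real.sqrt 3)) < c) :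
    ((ProbabilityTheory.cond (lebesgueWalk (stepLaw c)) (crossesAtZero 0)).map futurePast).map
      (fun q => (q.1, q.2.1)) = (overshootLaw c).prod (iidLaw ℕ (stepLaw c)) := by
  have hint := integrable_id_stepLaw c
  have hpos := integral_stepLaw_pos hc
  ext D hD
  have hf : Measurable fun q : ℝ × (ℕ → ℝ) × (ℕ → ℝ) => (q.1, q.2.1) := by fun_prop
  rw [Measure.map_apply hf hD, map_futurePast_apply hint hpos (stepLaw_Ioi_pos c) (hf hD),
    Measure.prod_apply hD]
  refine lintegral_congr_ae ?_
  filter_upwards [ae_overshootLaw_nonneg c] with y hy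
  have : IsProbabilityMeasure (ProbabilityTheory.cond (iidLaw ℕ (stepLaw c)) (staysAbove y)) :=
    cond_isProbabilityMeasure (iidLaw_staysAbove_pos hint hpos (stepLaw_Ioi_pos c) hy).ne'
  have hset : Prod.mk y ⁻¹' ((fun q : ℝ × (ℕ → ℝ) × (ℕ → ℝ) => (q.1, q.2.1)) ⁻¹' D) =
      (Prod.mk y ⁻¹' D) ×ˢ Set.univ := by ext; simp
  rw [hset, Measure.prod_prod, measure_univ, mul_one]

theorem map_plusPart_stationaryWalk (hc : Real.exp (-(Real.pi / Real.sqrt 3)) < c) :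
    (stationaryWalk (stepLaw c)).map plusPart = (walkLaw c (overshootLaw c)).map extendBot := by
  rw [walkLaw, ← map_start_future hc, stationaryWalk,
    Measure.map_map measurable_plusPart (by fun_prop), Measure.map_map (by fun_prop) (by fun_prop),
    Measure.map_map (by fun_prop) (by fun_prop),
    Measure.map_map (by fun_prop) (by fun_prop)]
  congr 1
  ext w n
  simp only [Function.comp, plusPart, extendBot, futurePast, walkPath]
  split_ifs with hn
  · rfl
  · obtain ⟨m, rfl⟩ := Int.eq_ofNat_of_zero_le (not_lt.1 hn)
    rfl

theorem isSpatiallyStationaryWalk_stationaryWalk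
    (hc : Real.exp (-(Real.pi / Real.sqrt 3)) < c) :
    IsSpatiallyStationaryWalk c (stationaryWalk (stepLaw c)) := by
  have hint := integrable_id_stepLaw c
  have hpos := integral_stepLaw_pos hc
  refine ⟨?_, ?_, ?_, map_spatialShift_stationaryWalk hint hpos, map_plusPart_stationaryWalk hc⟩
  · refine ae_stationaryWalk ?_ (Eventually.of_forall fun w n => EReal.coe_lt_top _)
    simp only [Set.ofPred_forall]
    exact .iInter fun n => measurableSet_lt (by fun_prop) measurable_const
  · refine ae_stationaryWalk ?_ ((tendsto_walkPath hint hpos).mono fun w hw => hw.2)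
    exact measurableSet_tendsto (𝓝 ⊥) fun n => measurable_pi_apply n
  · have h : ∀ᵐ ω ∂stationaryWalk (stepLaw c), Tendsto ω atTop (𝓝 ⊤) := by
      refine ae_stationaryWalk ?_ ((tendsto_walkPath hint hpos).mono fun w hw => hw.1)
      exact measurableSet_tendsto (𝓝 ⊤) fun n => measurable_pi_apply n
    exact h.mono fun ω hω => hω.limsup_eq

theorem map_eval_zero_stationaryWalk (hc : Real.exp (-(Real.pi / Real.sqrt 3)) < c) :
    (stationaryWalk (stepLaw c)).map (fun ω => ω 0) = (overshootLaw c).map Real.toEReal := by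
  have h := congrArg (Measure.map fun q : ℝ × (ℕ → ℝ) => (q.1 : EReal)) (map_start_future hc)
  have hm : Measurable fun q : ℝ × (ℕ → ℝ) => (q.1 : EReal) :=
    measurable_coe_real_ereal.comp measurable_fst
  rw [Measure.map_map hm (by fun_prop), Measure.map_map (hm.comp (by fun_prop)) (by fun_prop)] at h
  have h' : ((overshootLaw c).prod (iidLaw ℕ (stepLaw c))).map (fun q => (q.1 : EReal)) =
      (overshootLaw c).map Real.toEReal := by
    rw [← Function.comp_def Real.toEReal Prod.fst,
      ← Measure.map_map measurable_coe_real_ereal measurable_fst, Measure.map_fst_prod,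
      measure_univ, one_smul]
  rw [← h', ← h, stationaryWalk, Measure.map_map (by fun_prop) (by fun_prop)]
  congr 1
  ext w
  simp [walkPath, futurePast]

variable (c) in
theorem measurable_walkLaw_dirac {S : Set (ℕ → ℝ)} (hS : MeasurableSet S) :
    Measurable fun y => walkLaw c (Measure.dirac y) S := by
  have hm : Measurable fun (p : ℝ × (ℕ → ℝ)) (n : ℕ) => p.1 + partialSum p.2 n :=
    measurable_pi_lambda _ fun n => by fun_prop
  have h : ∀ y, walkLaw c (Measure.dirac y) S = iidLaw ℕ (stepLaw c)
      (Prod.mk y ⁻¹' ((fun (p : ℝ × (ℕ → ℝ)) (n : ℕ) => p.1 + partialSum p.2 n) ⁻¹' S)) :=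
    fun y => by rw [walkLaw_dirac, Measure.map_apply (measurable_add_partialSum y) hS]; rfl
  simp only [h]
  exact measurable_measure_prodMk_left (hm hS)

variable (c) in
/-- The law of the conditioned walk as a function of the opposite of its starting position. -/
def condPositiveKernel : Kernel EReal (ℕ → EReal) where
  toFun e := (walkCondPositive c (-e.toReal)).map fun s n => (s n : EReal)
  measurable' := by
    refine Measure.measurable_of_measurable_coe _ fun B hB => ?_
    have h : ∀ e : EReal, (walkCondPositive c (-e.toReal)).map (fun s n => (s n : EReal)) B =
        (walkLaw c (Measure.dirac (-e.toReal)) staysPositive)⁻¹ *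
          walkLaw c (Measure.dirac (-e.toReal))
            (staysPositive ∩ (fun s n => (s n : EReal)) ⁻¹' B) := fun e => by
      rw [Measure.map_apply measurable_coe_path hB, walkCondPositive,
        cond_apply measurableSet_staysPositive]
    simp only [h]
    have hneg : Measurable fun e : EReal => -e.toReal := measurable_ereal_toReal.neg
    exact ((measurable_walkLaw_dirac c measurableSet_staysPositive).comp hneg).inv.mul
      ((measurable_walkLaw_dirac c
        (measurableSet_staysPositive.inter (measurable_coe_path hB))).comp hneg)

instance : IsFiniteKernel (condPositiveKernel c) := by
  refine ⟨1, ENNReal.one_lt_top, fun e => ?_⟩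
  change (walkCondPositive c (-e.toReal)).map (fun s n => (s n : EReal)) Set.univ ≤ 1
  rw [Measure.map_apply measurable_coe_path MeasurableSet.univ, walkCondPositive]
  exact prob_le_one

theorem map_start_reversedPast (hc : Real.exp (-(Real.pi / Real.sqrt 3)) < c) :
    (stationaryWalk (stepLaw c)).map (fun ω => (ω 0, reversedPast ω)) =
      (stationaryWalk (stepLaw c)).map (fun ω => ω 0) ⊗ₘ condPositiveKernel c := by
  have hint := integrable_id_stepLaw c
  have hpos := integral_stepLaw_pos hc
  have := isProbabilityMeasure_stationaryWalk hc
  have hr := measurable_reversedPast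
  let g : ℝ × (ℕ → ℝ) × (ℕ → ℝ) → EReal × (ℕ → EReal) := fun q =>
    ((q.1 : EReal), fun n => ((-q.1 + partialSum q.2.2 n : ℝ) : EReal))
  have hg : Measurable g := by
    refine (measurable_coe_real_ereal.comp measurable_fst).prodMk
      (measurable_pi_lambda _ fun n => measurable_coe_real_ereal.comp (by fun_prop))
  have hmap : (stationaryWalk (stepLaw c)).map (fun ω => (ω 0, reversedPast ω)) =
      ((ProbabilityTheory.cond (lebesgueWalk (stepLaw c)) (crossesAtZero 0)).map futurePast).map g := by
    rw [stationaryWalk, Measure.map_map (by fun_prop) (by fun_prop),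
      Measure.map_map hg (by fun_prop)]
    congr 1
    ext w n
    · simp [walkPath, g, futurePast]
    · simp only [Function.comp, reversedPast, walkPath, g, futurePast, twoSidedSum_neg_natCast,
        ← EReal.coe_neg]
      congr 1; ring
  ext S hS
  have : SFinite ((overshootLaw c).map Real.toEReal) := by
    rw [← map_eval_zero_stationaryWalk hc]; infer_instance
  rw [hmap, Measure.map_apply hg hS,
    map_futurePast_apply hint hpos (stepLaw_Ioi_pos c) (hg hS), map_eval_zero_stationaryWalk hc,
    Measure.compProd_apply hS, lintegral_map (Kernel.measurable_kernel_prodMk_left hS)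
      measurable_coe_real_ereal]
  refine lintegral_congr fun y => ?_
  have hset : Prod.mk y ⁻¹' (g ⁻¹' S) = Set.univ ×ˢ
      ((fun (a : ℕ → ℝ) (n : ℕ) => -y + partialSum a n) ⁻¹'
        ((fun s n => (s n : EReal)) ⁻¹' (Prod.mk (y : EReal) ⁻¹' S))) := by ext; simp [g]
  have hS' : MeasurableSet (Prod.mk (y : EReal) ⁻¹' S) := measurable_prodMk_left hS
  change _ = (walkCondPositive c (-(y : EReal).toReal)).map (fun s n => (s n : EReal)) _
  rw [hset, Measure.prod_prod, measure_univ, one_mul, EReal.toReal_coe, walkCondPositive_eq,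
    Measure.map_apply measurable_coe_path hS',
    Measure.map_apply (measurable_add_partialSum _) (measurable_coe_path hS')]

end Stationary

theorem corollary3 (c : ℝ) (hc : Real.exp (-(Real.pi / Real.sqrt 3)) < c) :
    (∃! P : ProbabilityMeasure (ℤ → EReal), IsSpatiallyStationaryWalk c (P : Measure (ℤ → EReal))) ∧
    (∀ x : ℝ, 0 ≤ x → 0 < walkLaw c (Measure.dirac (-x)) staysPositive) ∧
    ∀ P : ProbabilityMeasure (ℤ → EReal), IsSpatiallyStationaryWalk c (P : Measure (ℤ → EReal)) →
      ∀ᵐ e ∂(P : Measure (ℤ → EReal)).map (fun ω => ω 0),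
        ∃ x : ℝ, 0 ≤ x ∧ e = (x : EReal) ∧
          condDistrib (fun (ω : ℤ → EReal) (n : ℕ) => -ω (-(n : ℤ))) (fun ω : ℤ → EReal => ω 0)
              (P : Measure (ℤ → EReal)) e
            = (walkCondPositive c (-x)).map (fun s n => (s n : EReal)) := by
  have hprob := isProbabilityMeasure_stationaryWalk hc
  have hstat := isSpatiallyStationaryWalk_stationaryWalk hc
  refine ⟨⟨⟨stationaryWalk (stepLaw c), hprob⟩, hstat, fun Q hQ => Subtype.ext (hQ.unique hstat)⟩,
    fun x hx => ?_, fun P hP => ?_⟩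
  · rw [walkLaw_staysPositive]
    exact iidLaw_staysAbove_pos (integrable_id_stepLaw c) (integral_stepLaw_pos hc)
      (stepLaw_Ioi_pos c) hx
  · obtain rfl : P = ⟨stationaryWalk (stepLaw c), hprob⟩ := Subtype.ext (hP.unique hstat)
    have hnn : ∀ᵐ e ∂(stationaryWalk (stepLaw c)).map (fun ω => ω 0), e ∈ Set.Ico (0 : EReal) ⊤ := by
      rw [map_eval_zero_stationaryWalk hc]
      refine (ae_map_iff (p := (· ∈ Set.Ico (0 : EReal) ⊤)) measurable_coe_real_ereal.aemeasurable
        measurableSet_Ico).2 ?_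
      filter_upwards [ae_overshootLaw_nonneg c] with y hy
      exact ⟨EReal.coe_nonneg.2 hy, EReal.coe_lt_top y⟩
    filter_upwards [condDistrib_ae_eq_of_measure_eq_compProd (μ := stationaryWalk (stepLaw c)) (fun ω : ℤ → EReal => ω 0)
      measurable_reversedPast.aemeasurable (map_start_reversedPast hc), hnn] with e he hnn
    refine ⟨e.toReal, EReal.toReal_nonneg hnn.1,
      (EReal.coe_toReal hnn.2.ne (EReal.bot_lt_zero.trans_le hnn.1).ne').symm, he⟩

end
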